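/- Let $A$ be a commutative Noetherian ring with a good notion of dimension: to every prime ideal $\mathfrak p$ of $A$ an integer $\dim A/\mathfrak p$ is assigned such that $\dim A/\mathfrak p=\dim A/\mathfrak q+1$ whenever $\mathfrak p\subsetneq\mathfrak q$ are primes with no prime strictly between them (for instance the Krull dimension, if it is finite for every $A/\mathfrak p$ and satisfies this rule). Assume also that for every prime $\mathfrak p$ the normalization of $A/\mathfrak p$ in its field of fractions is a finitely generated $A/\mathfrak p$-module. For $i\in\mathbb Z$ let $Z_i(A)$ be the free abelian group on the symbols $[A/\mathfrak q]$, $\mathfrak q$ a prime with $\dim A/\mathfrak q=i$, and let $Z_*(A)=\bigoplus_i Z_i(A)$. For a prime $\mathfrak p$ with $\dim A/\mathfrak p=i+1$ and $x\in A\setminus\mathfrak p$ put $$\operatorname{div}(\mathfrak p,x)=\sum_{\dim A/\mathfrak q=i}\ell_{A_{\mathfrak q}}\bigl(A_{\mathfrak q}/(\mathfrak p,x)A_{\mathfrak q}\bigr)\,[A/\mathfrak q]\in Z_i(A).$$ Two cycles in $Z_i(A)$ are rationally equivalent if their difference lies in the subgroup generated by all such $\operatorname{div}(\mathfrak p,x)$;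 cycles in $Z_*(A)$ are rationally equivalent if their components in each $Z_i(A)$ are. Let $CH_i(A)$ be $Z_i(A)$ modulo rational equivalence and $CH_*(A)=\bigoplus_i CH_i(A)$. Let $u\in A$. Give $A/uA$ the induced notion of dimension, so that primes of $A/uA$ correspond to primes of $A$ containing $u$ with the same dimension, and let $\alpha\mapsto(u)\cap\alpha$ be the homomorphism $Z_*(A)\to Z_*(A/uA)$ that sends $[A/\mathfrak p]$ to $0$ if $u\in\mathfrak p$ and to $\operatorname{div}(\mathfrak p,u)$, viewed as a cycle on $A/uA$, if $u\notin\mathfrak p$. Then, if $\alpha,\beta\in Z_*(A)$ are rationally equivalent, $(u)\cap\alpha$ and $(u)\cap\beta$ are rationally equivalent in $Z_*(A/uA)$. Hence there is a unique group homomorphism $CH_*(A)\to CH_*(A/uA)$ that sends the class of $\alpha$ to the class of $(u)\cap\alpha$ for every $\alpha\in Z_*(A)$. -/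

import Mathlib

namespace DivisorIntersection

/-- A good notion of dimension on a ring `A`: an integer `dim p`, to be thought of as the dimension
of `A / p`, for every prime ideal `p`, such that `dim p = dim q + 1` whenever `p < q` are prime
ideals with no prime ideal strictly between them. The Krull dimension of `A / p` is an example as
soon as it is finite for all `p` and satisfies this rule. -/
structure DimensionFunction (A : Type*) [CommRing A] where
  /-- the dimension of `A / p` -/
  dim : PrimeSpectrum A → ℤ
  dim_of_covBy : ∀ p q : PrimeSpectrum A, p ⋖ q → dim p = dim q + 1

section DimensionFunction

variable {A : Type*} [CommRing A] (δ : DimensionFunction A)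

theorem DimensionFunction.dim_lt_of_lt [IsNoetherianRing A] (p : PrimeSpectrum A) :
    ∀ q : PrimeSpectrum A, p < q → δ.dim q < δ.dim p := by
  have hwf : WellFounded (InvImage (· < ·) fun q : PrimeSpectrum A => q.asIdeal.height) :=
    InvImage.wf _ wellFounded_lt
  have hgt : WellFounded ((· > ·) : PrimeSpectrum A → PrimeSpectrum A → Prop) :=
    Subrelation.wf (r := InvImage (· > ·) PrimeSpectrum.asIdeal) (fun {a b} h => h)
      (InvImage.wf _ wellFounded_gt)
  have hco : IsStronglyCoatomic (PrimeSpectrum A) := IsStronglyCoatomic.of_wellFounded_gt hgt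
  intro q
  induction q using hwf.induction with
  | _ q ih =>
    intro hpq
    obtain ⟨x, hpx, hxq⟩ := exists_le_covBy_of_lt hpq
    have h1 := δ.dim_of_covBy x q hxq
    rcases hpx.eq_or_lt with rfl | hlt
    · omega
    · have h2 := ih x (Ideal.height_strict_mono_of_isPrime hxq.lt) hlt
      omega

/-- The dimension function of `A / uA` induced by one of `A`: the quotient of `A / uA` by a prime
ideal is the quotient of `A` by the preimage of that prime ideal. -/
def DimensionFunction.quotient (u : A) : DimensionFunction (A ⧸ Ideal.span {u}) where
  dim q := δ.dim (PrimeSpectrum.comap (Ideal.Quotient.mk (Ideal.span {u})) q)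
  dim_of_covBy p q h := by
    have hs : Function.Surjective (Ideal.Quotient.mk (Ideal.span {u})) :=
      Ideal.Quotient.mk_surjective
    have hle : ∀ a b : PrimeSpectrum (A ⧸ Ideal.span {u}),
        PrimeSpectrum.comap (Ideal.Quotient.mk (Ideal.span {u})) a ≤
          PrimeSpectrum.comap (Ideal.Quotient.mk (Ideal.span {u})) b ↔ a ≤ b := fun a b =>
      Ideal.comap_le_comap_iff_of_surjective _ hs a.asIdeal b.asIdeal
    have hlt : ∀ a b : PrimeSpectrum (A ⧸ Ideal.span {u}),
        PrimeSpectrum.comap (Ideal.Quotient.mk (Ideal.span {u})) a <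
          PrimeSpectrum.comap (Ideal.Quotient.mk (Ideal.span {u})) b ↔ a < b := fun a b => by
      rw [lt_iff_le_not_ge, lt_iff_le_not_ge, hle, hle]
    refine δ.dim_of_covBy _ _ ⟨(hlt _ _).2 h.lt, fun c hpc hcq => ?_⟩
    have hc : c ∈ Set.range (PrimeSpectrum.comap (Ideal.Quotient.mk (Ideal.span {u}))) := by
      rw [range_comap_of_surjective _ _ hs]
      exact (Ideal.comap_mono bot_le).trans hpc.le
    obtain ⟨c, rfl⟩ := hc
    exact h.2 ((hlt _ _).1 hpc) ((hlt _ _).1 hcq)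

end DimensionFunction

noncomputable section Cycles

variable {A : Type*} [CommRing A] (δ : DimensionFunction A)

/-- `Z_i(A)`: the free abelian group on the prime ideals `q` with `dim (A / q) = i`. -/
abbrev CyclesOfDim (i : ℤ) : Type _ := {q : PrimeSpectrum A // δ.dim q = i} →₀ ℤ

open scoped DirectSum in
/-- `Z_*(A)`: the direct sum of the groups `Z_i(A)`. -/
abbrev Cycles : Type _ := ⨁ i : ℤ, CyclesOfDim δ i

/-- The length of `A_q / (p, x) A_q` over `A_q`. It is finite whenever `dim p = dim q + 1` and
`x ∉ p`, which is the only case in which it is used. -/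
def multiplicity (p : PrimeSpectrum A) (x : A) (q : PrimeSpectrum A) : ℕ :=
  (Module.length (Localization.AtPrime q.asIdeal)
    (Localization.AtPrime q.asIdeal ⧸
      (p.asIdeal ⊔ Ideal.span {x}).map
        (algebraMap A (Localization.AtPrime q.asIdeal)))).toNat

theorem le_of_multiplicity_ne_zero {p q : PrimeSpectrum A} {x : A}
    (h : multiplicity p x q ≠ 0) : p.asIdeal ⊔ Ideal.span {x} ≤ q.asIdeal := by
  by_contra hle
  have htop : (p.asIdeal ⊔ Ideal.span {x}).map
      (algebraMap A (Localization.AtPrime q.asIdeal)) = ⊤ :=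
    IsLocalization.AtPrime.map_eq_top_of_not_le _ hle
  apply h
  have : Subsingleton (Localization.AtPrime q.asIdeal ⧸
      (p.asIdeal ⊔ Ideal.span {x}).map (algebraMap A (Localization.AtPrime q.asIdeal))) :=
    Ideal.Quotient.subsingleton_iff.2 htop
  rw [multiplicity, Module.length_eq_zero]
  rfl

theorem finite_support_multiplicity [IsNoetherianRing A] {i : ℤ} (p : PrimeSpectrum A)
    (hp : δ.dim p = i + 1) (x : A) (hx : x ∉ p.asIdeal) :
    (Function.support fun q : {q : PrimeSpectrum A // δ.dim q = i} =>
      (multiplicity p x q.1 : ℤ)).Finite := by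
  refine Set.Finite.of_finite_image
    (f := fun q : {q : PrimeSpectrum A // δ.dim q = i} => q.1.asIdeal)
    (((p.asIdeal ⊔ Ideal.span {x}).finite_minimalPrimes_of_isNoetherianRing).subset ?_) ?_
  · rintro _ ⟨⟨q, hq⟩, hmem, rfl⟩
    have hle : p.asIdeal ⊔ Ideal.span {x} ≤ q.asIdeal :=
      le_of_multiplicity_ne_zero (by simpa using hmem)
    obtain ⟨r, hr, hrq⟩ := Ideal.exists_minimalPrimes_le hle
    have hpr : p < ⟨r, hr.1.1⟩ := by
      refine lt_of_le_of_ne (le_sup_left.trans hr.1.2) ?_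
      intro h
      have hpr : p.asIdeal = r := congrArg PrimeSpectrum.asIdeal h
      exact hx (hpr ▸ hr.1.2 (Ideal.mem_sup_right (Ideal.mem_span_singleton_self x)))
    have h1 := δ.dim_lt_of_lt p _ hpr
    rcases hrq.eq_or_lt with rfl | hlt
    · exact hr
    · have h2 := δ.dim_lt_of_lt ⟨r, hr.1.1⟩ q hlt
      omega
  · intro a _ b _ hab
    exact Subtype.ext (PrimeSpectrum.ext hab)

/-- The cycle `div(p, x) = ∑ length (A_q / (p, x) A_q) [A / q]` in `Z_i(A)`, where
`dim (A / p) = i + 1` and `x ∉ p`; the sum is over all prime ideals `q` with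
`dim (A / q) = i`. -/
def divisor [IsNoetherianRing A] {i : ℤ} (p : PrimeSpectrum A) (hp : δ.dim p = i + 1) (x : A)
    (hx : x ∉ p.asIdeal) : CyclesOfDim δ i :=
  Finsupp.ofSupportFinite (fun q => (multiplicity p x q.1 : ℤ))
    (finite_support_multiplicity δ p hp x hx)

/-- The subgroup of `Z_i(A)` generated by the cycles `div(p, x)`. -/
def rationallyTrivial [IsNoetherianRing A] (i : ℤ) : AddSubgroup (CyclesOfDim δ i) :=
  AddSubgroup.closure
    {z | ∃ (p : PrimeSpectrum A) (hp : δ.dim p = i + 1) (x : A) (hx : x ∉ p.asIdeal),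
      z = divisor δ p hp x hx}

/-- Rational equivalence of cycles: in each dimension the difference is a sum of
cycles `± div(p, x)`. -/
def RationallyEquivalent [IsNoetherianRing A] (α β : Cycles δ) : Prop :=
  ∀ i : ℤ, α i - β i ∈ rationallyTrivial δ i

/-- `CH_i(A)`: the group `Z_i(A)` modulo rational equivalence. -/
abbrev ChowOfDim [IsNoetherianRing A] (i : ℤ) : Type _ :=
  CyclesOfDim δ i ⧸ rationallyTrivial δ i

open scoped DirectSum in
/-- The Chow group `CH_*(A)`: the direct sum of the groups `CH_i(A)`. -/
abbrev Chow [IsNoetherianRing A] : Type _ := ⨁ i : ℤ, ChowOfDim δ i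

/-- The class of a cycle in the Chow group. -/
def cycleClass [IsNoetherianRing A] : Cycles δ →+ Chow δ :=
  DirectSum.map fun i => QuotientAddGroup.mk' (rationallyTrivial δ i)

/-- A prime ideal of `A / uA`, viewed as a prime ideal of `A` containing `u`. -/
def liftPrime (u : A) (i : ℤ)
    (q : {q : PrimeSpectrum (A ⧸ Ideal.span {u}) // (δ.quotient u).dim q = i}) :
    {q : PrimeSpectrum A // δ.dim q = i} :=
  ⟨PrimeSpectrum.comap (Ideal.Quotient.mk (Ideal.span {u})) q.1, q.2⟩

theorem liftPrime_injective (u : A) (i : ℤ) : Function.Injective (liftPrime δ u i) := by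
  intro a b h
  exact Subtype.ext (PrimeSpectrum.comap_injective_of_surjective _
    Ideal.Quotient.mk_surjective (congrArg Subtype.val h))

/-- A cycle on `A` all of whose prime ideals contain `u`, viewed as a cycle on `A / uA`: the
coefficient at a prime ideal of `A / uA` is the coefficient at its preimage in `A`. (On arbitrary
cycles, the terms at prime ideals that do not contain `u` are dropped.) -/
def toQuotient (u : A) (i : ℤ) (z : CyclesOfDim δ i) : CyclesOfDim (δ.quotient u) i :=
  Finsupp.comapDomain (liftPrime δ u i) z (liftPrime_injective δ u i).injOn

/-- No term is lost when `div(p, u)` is viewed as a cycle on `A / uA`. -/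
theorem mapDomain_toQuotient_divisor [IsNoetherianRing A] (u : A) {i : ℤ} (p : PrimeSpectrum A)
    (hp : δ.dim p = i + 1) (hu : u ∉ p.asIdeal) :
    Finsupp.mapDomain (liftPrime δ u i) (toQuotient δ u i (divisor δ p hp u hu)) =
      divisor δ p hp u hu := by
  refine Finsupp.mapDomain_comapDomain _ (liftPrime_injective δ u i) _ ?_
  intro q hq
  have hle : p.asIdeal ⊔ Ideal.span {u} ≤ q.1.asIdeal := by
    refine le_of_multiplicity_ne_zero ?_
    simpa [divisor, Finsupp.ofSupportFinite] using hq
  have hr : q.1 ∈ Set.range (PrimeSpectrum.comap (Ideal.Quotient.mk (Ideal.span {u}))) := by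
    rw [range_comap_of_surjective _ _ Ideal.Quotient.mk_surjective,
      Ideal.mk_ker]
    exact le_sup_right.trans hle
  obtain ⟨r, hr⟩ := hr
  exact ⟨⟨r, (congrArg δ.dim hr).trans q.2⟩, Subtype.ext hr⟩

open scoped Classical in
/-- `(u) ∩ [A / p]` for a prime ideal `p` with `dim (A / p) = i`: it is `0` if `u ∈ p` and
`div(p, u)`, as a cycle of dimension `i - 1` on `A / uA`, if `u ∉ p`. -/
def intersectPrime [IsNoetherianRing A] (u : A) (i : ℤ)
    (p : {p : PrimeSpectrum A // δ.dim p = i}) : CyclesOfDim (δ.quotient u) (i - 1) :=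
  if hu : u ∈ p.1.asIdeal then 0
  else toQuotient δ u (i - 1) (divisor δ p.1 (p.2.trans (sub_add_cancel i 1).symm) u hu)

/-- The additive extension `Z_i(A) → Z_{i-1}(A / uA)` of `[A / p] ↦ (u) ∩ [A / p]`. -/
def intersectOfDim [IsNoetherianRing A] (u : A) (i : ℤ) :
    CyclesOfDim δ i →+ CyclesOfDim (δ.quotient u) (i - 1) :=
  Finsupp.liftAddHom fun p => zmultiplesHom _ (intersectPrime δ u i p)

/-- Intersection with `(u)`, the homomorphism `α ↦ (u) ∩ α` from `Z_*(A)` to `Z_*(A / uA)`. -/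
def intersect [IsNoetherianRing A] (u : A) : Cycles δ →+ Cycles (δ.quotient u) :=
  DirectSum.toAddMonoid fun i =>
    (DirectSum.of (fun j => CyclesOfDim (δ.quotient u) j) (i - 1)).comp (intersectOfDim δ u i)

end Cycles

end DivisorIntersection

universe u

namespace DivisorIntersection

/-- A length function on the category of modules over a ring: a function with values in `ℕ∞` that
is additive in short exact sequences. -/
structure LengthFunction (R : Type u) [CommRing R] where
  /-- the length of a module -/
  toFun : (M : Type u) → [AddCommGroup M] → [Module R M] → ℕ∞
  eq_zero : ∀ (M : Type u) [AddCommGroup M] [Module R M] [Subsingleton M], toFun M = 0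
  eq_add : ∀ {N M P : Type u} [AddCommGroup N] [AddCommGroup M] [AddCommGroup P]
    [Module R N] [Module R M] [Module R P] (f : N →ₗ[R] M) (g : M →ₗ[R] P),
    Function.Injective f → Function.Surjective g → Function.Exact f g →
    toFun M = toFun N + toFun P

namespace LengthFunction

variable {R : Type u} [CommRing R] (l : LengthFunction R)

section Basic

variable {M N P : Type u} [AddCommGroup M] [AddCommGroup N] [AddCommGroup P]
  [Module R M] [Module R N] [Module R P]

theorem congr (e : M ≃ₗ[R] N) : l.toFun M = l.toFun N := by
  have h := l.eq_add (P := PUnit.{u + 1}) e.toLinearMap (0 : N →ₗ[R] PUnit.{u + 1}) e.injective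
    (Function.surjective_to_subsingleton _) ((e.toLinearMap.exact_zero_iff_surjective _).2 e.surjective)
  rw [h, l.eq_zero PUnit, add_zero]

theorem eq_ker_add_range (f : M →ₗ[R] N) :
    l.toFun M = l.toFun (LinearMap.ker f) + l.toFun (LinearMap.range f) :=
  l.eq_add (LinearMap.ker f).subtype f.rangeRestrict (Submodule.injective_subtype _)
    f.surjective_rangeRestrict (by
      rw [LinearMap.exact_iff, LinearMap.ker_rangeRestrict, Submodule.range_subtype])

theorem eq_submodule_add_quotient (Q : Submodule R M) :
    l.toFun M = l.toFun Q + l.toFun (M ⧸ Q) :=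
  l.eq_add Q.subtype Q.mkQ (Submodule.injective_subtype _) (Submodule.mkQ_surjective _)
    (LinearMap.exact_subtype_mkQ _)

theorem le_of_injective (f : M →ₗ[R] N) (hf : Function.Injective f) : l.toFun M ≤ l.toFun N := by
  rw [l.congr (LinearEquiv.ofInjective f hf), l.eq_submodule_add_quotient (LinearMap.range f)]
  exact le_self_add

theorem le_of_surjective (f : M →ₗ[R] N) (hf : Function.Surjective f) :
    l.toFun N ≤ l.toFun M := by
  rw [l.eq_ker_add_range f, LinearMap.range_eq_top.2 hf, l.congr Submodule.topEquiv]
  exact le_add_self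

theorem eq_range_add_range {f : M →ₗ[R] N} {g : N →ₗ[R] P} (h : Function.Exact f g) :
    l.toFun N = l.toFun (LinearMap.range f) + l.toFun (LinearMap.range g) := by
  rw [l.eq_ker_add_range g, LinearMap.exact_iff.1 h]

end Basic

/-- The length of the kernel and of the cokernel of multiplication by `a` are finite. -/
def HerbrandFinite (a : R) (M : Type u) [AddCommGroup M] [Module R M] : Prop :=
  l.toFun (LinearMap.ker (LinearMap.lsmul R M a)) ≠ ⊤ ∧
    l.toFun (M ⧸ LinearMap.range (LinearMap.lsmul R M a)) ≠ ⊤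

/-- The length of the cokernel of multiplication by `a` minus the length of its kernel. -/
noncomputable def herbrand (a : R) (M : Type u) [AddCommGroup M] [Module R M] : ℤ :=
  ((l.toFun (M ⧸ LinearMap.range (LinearMap.lsmul R M a))).toNat : ℤ) -
    (l.toFun (LinearMap.ker (LinearMap.lsmul R M a))).toNat

section Herbrand

variable {M N P : Type u} [AddCommGroup M] [AddCommGroup N] [AddCommGroup P]
  [Module R M] [Module R N] [Module R P]

theorem snake (a : R) (f : N →ₗ[R] M) (g : M →ₗ[R] P) (hf : Function.Injective f)
    (hg : Function.Surjective g) (h : Function.Exact f g) :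
    ∃ x y z : ℕ∞,
      l.toFun (LinearMap.ker (LinearMap.lsmul R M a)) =
        l.toFun (LinearMap.ker (LinearMap.lsmul R N a)) + x ∧
      l.toFun (LinearMap.ker (LinearMap.lsmul R P a)) = x + y ∧
      l.toFun (N ⧸ LinearMap.range (LinearMap.lsmul R N a)) = y + z ∧
      l.toFun (M ⧸ LinearMap.range (LinearMap.lsmul R M a)) =
        z + l.toFun (P ⧸ LinearMap.range (LinearMap.lsmul R P a)) := by
  have h1 : f.comp (LinearMap.lsmul R N a) = (LinearMap.lsmul R M a).comp f := by ext; simp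
  have h2 : g.comp (LinearMap.lsmul R M a) = (LinearMap.lsmul R P a).comp g := by ext; simp
  let K1 : LinearMap.ker (LinearMap.lsmul R N a) →ₗ[R] LinearMap.ker (LinearMap.lsmul R M a) :=
    f.restrict fun x hx => by
      rw [LinearMap.mem_ker] at hx ⊢
      rw [← LinearMap.comp_apply, ← h1, LinearMap.comp_apply, hx, map_zero]
  let K2 : LinearMap.ker (LinearMap.lsmul R M a) →ₗ[R] LinearMap.ker (LinearMap.lsmul R P a) :=
    g.restrict fun x hx => by
      rw [LinearMap.mem_ker] at hx ⊢
      rw [← LinearMap.comp_apply, ← h2, LinearMap.comp_apply, hx, map_zero]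
  have hc1 : LinearMap.range (LinearMap.lsmul R N a) ≤
      (LinearMap.range (LinearMap.lsmul R M a)).comap f := by
    rintro _ ⟨x, rfl⟩
    exact ⟨f x, (LinearMap.congr_fun h1 x).symm⟩
  have hc2 : LinearMap.range (LinearMap.lsmul R M a) ≤
      (LinearMap.range (LinearMap.lsmul R P a)).comap g := by
    rintro _ ⟨x, rfl⟩
    exact ⟨g x, (LinearMap.congr_fun h2 x).symm⟩
  let C1 := Submodule.mapQ _ _ f hc1
  let C2 := Submodule.mapQ _ _ g hc2
  have hK1 : Function.Injective K1 := fun x y hxy =>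
    Subtype.ext (hf (congrArg Subtype.val hxy))
  have hC2 : Function.Surjective C2 := by
    intro y
    obtain ⟨y, rfl⟩ := Submodule.mkQ_surjective _ y
    obtain ⟨x, rfl⟩ := hg y
    exact ⟨Submodule.mkQ _ x, rfl⟩
  have hKK : Function.Exact K1 K2 := by
    intro y
    constructor
    · intro hy
      obtain ⟨x, hx⟩ := (h y.1).1 (congrArg Subtype.val hy)
      refine ⟨⟨x, ?_⟩, Subtype.ext hx⟩
      rw [LinearMap.mem_ker]
      apply hf
      rw [← LinearMap.comp_apply, h1, LinearMap.comp_apply, hx, y.2, map_zero]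
    · rintro ⟨x, rfl⟩
      exact Subtype.ext (h.apply_apply_eq_zero x.1)
  have hCC : Function.Exact C1 C2 := by
    intro y
    constructor
    · obtain ⟨y, rfl⟩ := Submodule.mkQ_surjective _ y
      intro hy
      have hy' : g y ∈ LinearMap.range (LinearMap.lsmul R P a) :=
        (Submodule.Quotient.mk_eq_zero _).1 hy
      obtain ⟨z, hz⟩ := hy'
      obtain ⟨w, rfl⟩ := hg z
      have : g (y - a • w) = 0 := by
        rw [map_sub, map_smul, ← hz]; simp
      obtain ⟨x, hx⟩ := (h _).1 this
      refine ⟨Submodule.mkQ _ x, ?_⟩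
      have : C1 (Submodule.mkQ _ x) = Submodule.mkQ _ (f x) := rfl
      rw [this, hx, map_sub, sub_eq_self]
      exact (Submodule.Quotient.mk_eq_zero _).2 ⟨w, rfl⟩
    · rintro ⟨x, rfl⟩
      obtain ⟨x, rfl⟩ := Submodule.mkQ_surjective _ x
      change Submodule.mkQ _ (g (f x)) = 0
      rw [h.apply_apply_eq_zero, map_zero]
  let ι (M : Type u) [AddCommGroup M] [Module R M] := (LinearMap.ker (LinearMap.lsmul R M a)).subtype
  let π (M : Type u) [AddCommGroup M] [Module R M] :=
    (LinearMap.range (LinearMap.lsmul R M a)).mkQ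
  have hι : ∀ (M : Type u) [AddCommGroup M] [Module R M],
      Function.Exact (ι M) (LinearMap.lsmul R M a) := fun M _ _ =>
    LinearMap.exact_subtype_ker_map _
  have hπ : ∀ (M : Type u) [AddCommGroup M] [Module R M],
      Function.Exact (LinearMap.lsmul R M a) (π M) := fun M _ _ =>
    LinearMap.exact_map_mkQ_range _
  have e1 := SnakeLemma.exact_δ'_right (LinearMap.lsmul R N a) (LinearMap.lsmul R M a)
    (LinearMap.lsmul R P a) f g h f g h h1 h2 (ι M) (hι M) (ι P) (hι P) (π N) (hπ N) hg hf K2 rfl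
    (Submodule.injective_subtype _)
  have e2 := SnakeLemma.exact_δ'_left (LinearMap.lsmul R N a) (LinearMap.lsmul R M a)
    (LinearMap.lsmul R P a) f g h f g h h1 h2 (ι P) (hι P) (π N) (hπ N) (π M) (hπ M) hg hf C1 rfl
    (Submodule.mkQ_surjective _)
  refine ⟨_, _, _, ?_, l.eq_range_add_range e1, l.eq_range_add_range e2, ?_⟩
  · rw [l.eq_range_add_range hKK, l.congr (LinearEquiv.ofInjective K1 hK1)]
  · rw [l.eq_range_add_range hCC, LinearMap.range_eq_top.2 hC2, l.congr Submodule.topEquiv]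

theorem HerbrandFinite.of_exact {a : R} (f : N →ₗ[R] M) (g : M →ₗ[R] P)
    (hf : Function.Injective f) (hg : Function.Surjective g) (h : Function.Exact f g)
    (hN : l.HerbrandFinite a N) (hP : l.HerbrandFinite a P) : l.HerbrandFinite a M := by
  obtain ⟨x, y, z, h1, h2, h3, h4⟩ := l.snake a f g hf hg h
  obtain ⟨n1, n2⟩ := hN
  obtain ⟨p1, p2⟩ := hP
  rw [h2] at p1
  rw [h3] at n2
  simp only [HerbrandFinite, h1, h4, ne_eq, ENat.add_eq_top, not_or] at *
  tauto

theorem herbrand_eq_add {a : R} (f : N →ₗ[R] M) (g : M →ₗ[R] P)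
    (hf : Function.Injective f) (hg : Function.Surjective g) (h : Function.Exact f g)
    (hN : l.HerbrandFinite a N) (hP : l.HerbrandFinite a P) :
    l.herbrand a M = l.herbrand a N + l.herbrand a P := by
  obtain ⟨x, y, z, h1, h2, h3, h4⟩ := l.snake a f g hf hg h
  obtain ⟨n1, n2⟩ := hN
  obtain ⟨p1, p2⟩ := hP
  rw [h2] at p1
  rw [h3] at n2
  simp only [ne_eq, ENat.add_eq_top, not_or] at *
  rw [herbrand, herbrand, herbrand, h1, h2, h3, h4, ENat.toNat_add n1 p1.1,
    ENat.toNat_add p1.1 p1.2, ENat.toNat_add n2.1 n2.2, ENat.toNat_add n2.2 p2]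
  push_cast
  ring

theorem ker_eq_coker {a : R} (hM : l.toFun M ≠ ⊤) :
    l.toFun (LinearMap.ker (LinearMap.lsmul R M a)) =
      l.toFun (M ⧸ LinearMap.range (LinearMap.lsmul R M a)) := by
  have h1 := l.eq_ker_add_range (LinearMap.lsmul R M a)
  have h2 := l.eq_submodule_add_quotient (LinearMap.range (LinearMap.lsmul R M a))
  have h3 : l.toFun (LinearMap.range (LinearMap.lsmul R M a)) ≠ ⊤ := by
    intro h
    rw [h2, h, top_add] at hM
    exact hM rfl
  rw [h1, add_comm] at h2
  exact (ENat.add_right_injective_of_ne_top h3) h2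

theorem herbrandFinite_of_ne_top (a : R) (hM : l.toFun M ≠ ⊤) : l.HerbrandFinite a M :=
  ⟨ne_top_of_le_ne_top hM (l.le_of_injective _ (Submodule.injective_subtype _)),
    ne_top_of_le_ne_top hM (l.le_of_surjective _ (Submodule.mkQ_surjective _))⟩

theorem herbrand_eq_zero (a : R) (hM : l.toFun M ≠ ⊤) : l.herbrand a M = 0 := by
  rw [herbrand, l.ker_eq_coker hM, sub_self]

theorem herbrandFinite_congr {a : R} (e : M ≃ₗ[R] N) (h : l.HerbrandFinite a M) :
    l.HerbrandFinite a N :=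
  HerbrandFinite.of_exact l (P := PUnit.{u + 1}) e.toLinearMap 0 e.injective
    (Function.surjective_to_subsingleton _)
    ((e.toLinearMap.exact_zero_iff_surjective _).2 e.surjective) h
    (l.herbrandFinite_of_ne_top _ (by rw [l.eq_zero]; exact ENat.zero_ne_top))

end Herbrand

/-- The cokernel of multiplication by `a` on `R / I`. -/
noncomputable def quotientRangeEquiv (I : Ideal R) (a : R) :
    ((R ⧸ I) ⧸ LinearMap.range (LinearMap.lsmul R (R ⧸ I) a)) ≃ₗ[R]
      R ⧸ (I ⊔ Ideal.span {a}) :=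
  (Submodule.quotEquivOfEq _ _ (by
    ext x
    obtain ⟨x, rfl⟩ := Submodule.mkQ_surjective _ x
    simp only [Submodule.mem_map, LinearMap.mem_range]
    constructor
    · rintro ⟨y, hy⟩
      obtain ⟨y, rfl⟩ := Submodule.mkQ_surjective _ y
      exact ⟨a * y, Ideal.mul_mem_right _ _ (Ideal.mem_span_singleton_self a), hy⟩
    · rintro ⟨y, hy, hyx⟩
      obtain ⟨z, rfl⟩ := Ideal.mem_span_singleton.1 hy
      exact ⟨Submodule.mkQ _ z, hyx⟩)).trans
    ((Submodule.quotientQuotientEquivQuotientSup I (Ideal.span {a})))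

theorem ker_lsmul_quotient {I : Ideal R} {a : R} (ha : ∀ b, a * b ∈ I → b ∈ I) :
    LinearMap.ker (LinearMap.lsmul R (R ⧸ I) a) = ⊥ := by
  rw [eq_bot_iff]
  intro x hx
  obtain ⟨x, rfl⟩ := Submodule.mkQ_surjective _ x
  rw [Submodule.mem_bot]
  exact (Submodule.Quotient.mk_eq_zero _).2 (ha x ((Submodule.Quotient.mk_eq_zero _).1 hx))

theorem herbrand_quotient {I : Ideal R} {a : R} (ha : ∀ b, a * b ∈ I → b ∈ I) :
    l.herbrand a (R ⧸ I) = (l.toFun (R ⧸ (I ⊔ Ideal.span {a}))).toNat := by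
  rw [herbrand, ker_lsmul_quotient ha, l.eq_zero (⊥ : Submodule R (R ⧸ I)),
    l.congr (quotientRangeEquiv I a)]
  simp

theorem herbrandFinite_quotient {I : Ideal R} {a : R} (ha : ∀ b, a * b ∈ I → b ∈ I)
    (h : l.toFun (R ⧸ (I ⊔ Ideal.span {a})) ≠ ⊤) : l.HerbrandFinite a (R ⧸ I) := by
  rw [HerbrandFinite, ker_lsmul_quotient ha, l.eq_zero (⊥ : Submodule R (R ⧸ I)),
    l.congr (quotientRangeEquiv I a)]
  exact ⟨ENat.zero_ne_top, h⟩

/-- The length function on `S`-modules given by the length of the underlying `R`-module. -/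
noncomputable def restrict (S : Type u) [CommRing S] [Algebra R S] : LengthFunction S where
  toFun M _ _ :=
    let _ := Module.compHom M (algebraMap R S)
    l.toFun M
  eq_zero M _ _ _ :=
    let _ := Module.compHom M (algebraMap R S)
    l.eq_zero M
  eq_add {N M P} _ _ _ _ _ _ f g hf hg h := by
    let _ := Module.compHom N (algebraMap R S)
    let _ := Module.compHom M (algebraMap R S)
    let _ := Module.compHom P (algebraMap R S)
    let f' : N →ₗ[R] M :=
      { toFun := f
        map_add' := f.map_add
        map_smul' := fun r x => f.map_smul (algebraMap R S r) x }
    let g' : M →ₗ[R] P :=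
      { toFun := g
        map_add' := g.map_add
        map_smul' := fun r x => g.map_smul (algebraMap R S r) x }
    exact l.eq_add f' g' hf hg h

theorem restrict_apply (S : Type u) [CommRing S] [Algebra R S] (M : Type u) [AddCommGroup M]
    [Module S M] [i : Module R M] [IsScalarTower R S M] :
    (l.restrict S).toFun M = l.toFun M := by
  have : Module.compHom M (algebraMap R S) = i := by
    refine Module.ext' _ _ fun r x => ?_
    exact algebraMap_smul S r x
  subst this
  rfl

end LengthFunction

open PrimeSpectrum

variable {R : Type u} [CommRing R]

/-- The length of the localization of a module at a prime ideal. -/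
noncomputable def localLength (p : PrimeSpectrum R) : LengthFunction R where
  toFun M _ _ := Module.length (Localization.AtPrime p.asIdeal)
    (LocalizedModule p.asIdeal.primeCompl M)
  eq_zero _ _ _ _ := Module.length_eq_zero
  eq_add {N M P} _ _ _ _ _ _ f g hf hg h :=
    Module.length_eq_add_of_exact (LocalizedModule.map p.asIdeal.primeCompl f)
      (LocalizedModule.map p.asIdeal.primeCompl g)
      (IsLocalizedModule.map_injective p.asIdeal.primeCompl
        (LocalizedModule.mkLinearMap p.asIdeal.primeCompl N)
        (LocalizedModule.mkLinearMap p.asIdeal.primeCompl M) f hf)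
      (IsLocalizedModule.map_surjective p.asIdeal.primeCompl
        (LocalizedModule.mkLinearMap p.asIdeal.primeCompl M)
        (LocalizedModule.mkLinearMap p.asIdeal.primeCompl P) g hg)
      (LocalizedModule.map_exact p.asIdeal.primeCompl f g h)

theorem localLength_quotient (p : PrimeSpectrum R) (I : Ideal R) :
    (localLength p).toFun (R ⧸ I) = Module.length (Localization.AtPrime p.asIdeal)
      (Localization.AtPrime p.asIdeal ⧸ I.map (algebraMap R (Localization.AtPrime p.asIdeal))) := by
  have := IsLocalization.linearMap_compatibleSMul p.asIdeal.primeCompl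
  have e : Submodule.localized' (Localization.AtPrime p.asIdeal) p.asIdeal.primeCompl
      (Algebra.linearMap R (Localization.AtPrime p.asIdeal)) I =
      I.map (algebraMap R (Localization.AtPrime p.asIdeal)) := Ideal.localized'_eq_map _ _ _
  rw [← e]
  refine LinearEquiv.length_eq ?_
  exact (IsLocalizedModule.linearEquiv p.asIdeal.primeCompl
    (LocalizedModule.mkLinearMap p.asIdeal.primeCompl (R ⧸ I))
    (Submodule.toLocalizedQuotient' (Localization.AtPrime p.asIdeal) p.asIdeal.primeCompl
      (Algebra.linearMap R (Localization.AtPrime p.asIdeal)) I)).restrictScalars _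

theorem multiplicity_eq (p q : PrimeSpectrum R) (x : R) :
    multiplicity p x q = ((localLength q).toFun (R ⧸ (p.asIdeal ⊔ Ideal.span {x}))).toNat := by
  rw [localLength_quotient]
  rfl

theorem localLength_eq_zero_iff (p : PrimeSpectrum R) (M : Type u) [AddCommGroup M] [Module R M] :
    (localLength p).toFun M = 0 ↔ p ∉ Module.support R M := by
  rw [Module.notMem_support_iff]
  exact Module.length_eq_zero_iff

theorem mem_support_quotient {I : Ideal R} {p : PrimeSpectrum R} :
    p ∈ Module.support R (R ⧸ I) ↔ I ≤ p.asIdeal := by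
  rw [Module.support_eq_zeroLocus, Ideal.annihilator_quotient]
  rfl

theorem localLength_quotient_eq_zero {p q : PrimeSpectrum R} (h : ¬ q ≤ p) :
    (localLength p).toFun (R ⧸ q.asIdeal) = 0 := by
  rw [localLength_eq_zero_iff, mem_support_quotient]
  exact h

theorem localLength_quotient_self (p : PrimeSpectrum R) :
    (localLength p).toFun (R ⧸ p.asIdeal) = 1 := by
  rw [localLength_quotient, Localization.AtPrime.map_eq_maximalIdeal, Module.length_eq_one_iff]
  exact isSimpleModule_iff_isCoatom.2 (Ideal.isMaximal_def.1 inferInstance)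

/-- A function on finite modules with support in `C` that is additive in short exact sequences. -/
structure AdditiveOn (C : Set (PrimeSpectrum R)) where
  /-- the value at a module -/
  toFun : (M : Type u) → [AddCommGroup M] → [Module R M] → ℤ
  eq_add : ∀ {N M P : Type u} [AddCommGroup N] [AddCommGroup M] [AddCommGroup P]
    [Module R N] [Module R M] [Module R P] [Module.Finite R N] [Module.Finite R M]
    [Module.Finite R P] (f : N →ₗ[R] M) (g : M →ₗ[R] P), Module.support R M ⊆ C →
    Function.Injective f → Function.Surjective g → Function.Exact f g →
    toFun M = toFun N + toFun P

section Devissage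

variable {C : Set (PrimeSpectrum R)}

theorem AdditiveOn.eq_zero (φ : AdditiveOn C) (M : Type u) [AddCommGroup M] [Module R M]
    [Subsingleton M] : φ.toFun M = 0 := by
  have h := φ.eq_add (N := M) (M := M) (P := M) 0 0 (by simp [Module.support_eq_empty])
    (Function.injective_of_subsingleton _) (Function.surjective_to_subsingleton _)
    (fun x => by simp [Subsingleton.elim x 0])
  omega

theorem AdditiveOn.congr (φ : AdditiveOn C) {M N : Type u} [AddCommGroup M] [Module R M]
    [AddCommGroup N] [Module R N] [Module.Finite R M] [Module.Finite R N] (e : M ≃ₗ[R] N)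
    (h : Module.support R N ⊆ C) : φ.toFun M = φ.toFun N := by
  have h := φ.eq_add (P := PUnit.{u + 1}) e.toLinearMap (0 : N →ₗ[R] PUnit.{u + 1}) h e.injective
    (Function.surjective_to_subsingleton _)
    ((e.toLinearMap.exact_zero_iff_surjective _).2 e.surjective)
  rw [h, φ.eq_zero PUnit, add_zero]

variable [IsNoetherianRing R]

theorem induction_on_support {motive : (M : Type u) → [AddCommGroup M] → [Module R M] → Prop}
    (zero : ∀ (M : Type u) [AddCommGroup M] [Module R M] [Subsingleton M], motive M)
    (quotient : ∀ p ∈ C, ∀ (M : Type u) [AddCommGroup M] [Module R M] [Module.Finite R M],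
      Module.support R M ⊆ C → (M ≃ₗ[R] R ⧸ p.asIdeal) → motive M)
    (exact : ∀ (N M P : Type u) [AddCommGroup N] [AddCommGroup M] [AddCommGroup P]
      [Module R N] [Module R M] [Module R P] [Module.Finite R N] [Module.Finite R M]
      [Module.Finite R P] (f : N →ₗ[R] M) (g : M →ₗ[R] P), Module.support R M ⊆ C →
      Module.support R N ⊆ C → Module.support R P ⊆ C →
      Function.Injective f → Function.Surjective g → Function.Exact f g →
      motive N → motive P → motive M)
    (M : Type u) [AddCommGroup M] [Module R M] [hM : Module.Finite R M]
    (h : Module.support R M ⊆ C) : motive M := by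
  revert h
  induction hM using IsNoetherianRing.induction_on_isQuotientEquivQuotientPrime R with
  | subsingleton N => exact fun _ => zero N
  | quotient N p e =>
    intro h
    refine quotient p (h ?_) N h e
    rw [e.support_eq, mem_support_quotient]
  | exact N M P f g hf hg hfg ihN ihP =>
    intro h
    have h1 := (Module.support_subset_of_injective f hf).trans h
    have h2 := (Module.support_subset_of_surjective g hg).trans h
    exact exact N M P f g h h1 h2 hf hg hfg (ihN h1) (ihP h2)

theorem LengthFunction.ne_top_of_support (l : LengthFunction R)
    (hC : ∀ p ∈ C, l.toFun (R ⧸ p.asIdeal) ≠ ⊤) (M : Type u) [AddCommGroup M] [Module R M]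
    [Module.Finite R M] (h : Module.support R M ⊆ C) : l.toFun M ≠ ⊤ := by
  refine induction_on_support (C := C) (motive := fun M _ _ => l.toFun M ≠ ⊤) ?_ ?_ ?_ M h
  · intro M _ _ _
    rw [l.eq_zero]
    exact ENat.zero_ne_top
  · intro p hp M _ _ _ _ e
    rw [l.congr e]
    exact hC p hp
  · intro N M P _ _ _ _ _ _ _ _ _ f g _ _ _ hf hg hfg hN hP
    rw [l.eq_add f g hf hg hfg]
    simp [hN, hP]

theorem LengthFunction.herbrandFinite_of_support (l : LengthFunction R) (a : R)
    (hC : ∀ p ∈ C, l.HerbrandFinite a (R ⧸ p.asIdeal)) (M : Type u) [AddCommGroup M] [Module R M]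
    [Module.Finite R M] (h : Module.support R M ⊆ C) : l.HerbrandFinite a M := by
  refine induction_on_support (C := C) (motive := fun M _ _ => l.HerbrandFinite a M) ?_ ?_ ?_ M h
  · intro M _ _ _
    refine l.herbrandFinite_of_ne_top _ ?_
    rw [l.eq_zero]
    exact ENat.zero_ne_top
  · intro p hp M _ _ _ _ e
    exact l.herbrandFinite_congr e.symm (hC p hp)
  · intro N M P _ _ _ _ _ _ _ _ _ f g _ _ _ hf hg hfg hN hP
    exact .of_exact l f g hf hg hfg hN hP

/-- A length function, on modules where it is finite. -/
noncomputable def LengthFunction.toAdditiveOn (l : LengthFunction R)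
    (hC : ∀ p ∈ C, l.toFun (R ⧸ p.asIdeal) ≠ ⊤) : AdditiveOn C where
  toFun M _ _ := (l.toFun M).toNat
  eq_add {N M P} _ _ _ _ _ _ _ _ _ f g h hf hg hfg := by
    rw [l.eq_add f g hf hg hfg, ENat.toNat_add, Nat.cast_add]
    · exact l.ne_top_of_support hC N ((Module.support_subset_of_injective f hf).trans h)
    · exact l.ne_top_of_support hC P ((Module.support_subset_of_surjective g hg).trans h)

/-- The Herbrand difference, on modules where it is defined. -/
noncomputable def LengthFunction.herbrandAdditiveOn (l : LengthFunction R) (a : R)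
    (hC : ∀ p ∈ C, l.HerbrandFinite a (R ⧸ p.asIdeal)) : AdditiveOn C where
  toFun M _ _ := l.herbrand a M
  eq_add {N _ P} _ _ _ _ _ _ _ _ _ f g h hf hg hfg := l.herbrand_eq_add f g hf hg hfg
    (l.herbrandFinite_of_support a hC N ((Module.support_subset_of_injective f hf).trans h))
    (l.herbrandFinite_of_support a hC P ((Module.support_subset_of_surjective g hg).trans h))

theorem localLength_ne_top_of_minimal {p : PrimeSpectrum R} (hp : ∀ q ∈ C, q ≤ p → q = p)
    (M : Type u) [AddCommGroup M] [Module R M] [Module.Finite R M]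
    (h : Module.support R M ⊆ C) : (localLength p).toFun M ≠ ⊤ := by
  refine (localLength p).ne_top_of_support (C := C) (fun q hq => ?_) M h
  by_cases hqp : q ≤ p
  · rw [hp q hq hqp, localLength_quotient_self]
    exact ENat.one_ne_top
  · rw [localLength_quotient_eq_zero hqp]
    exact ENat.zero_ne_top

/-- An additive function that vanishes on `R / p` for all `p ∈ C` outside a finite set of minimal
elements of `C` is determined by its values at these. -/
theorem AdditiveOn.eq_sum (φ : AdditiveOn C) (F : Finset (PrimeSpectrum R))
    (hF : ∀ p ∈ F, ∀ q ∈ C, q ≤ p → q = p)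
    (h0 : ∀ p ∈ C, p ∉ F → φ.toFun (R ⧸ p.asIdeal) = 0)
    (M : Type u) [AddCommGroup M] [Module R M] [Module.Finite R M]
    (h : Module.support R M ⊆ C) :
    φ.toFun M = ∑ p ∈ F, (((localLength p).toFun M).toNat : ℤ) * φ.toFun (R ⧸ p.asIdeal) := by
  refine induction_on_support (C := C) (motive := fun M _ _ => φ.toFun M =
    ∑ p ∈ F, (((localLength p).toFun M).toNat : ℤ) * φ.toFun (R ⧸ p.asIdeal)) ?_ ?_ ?_ M h
  · intro M _ _ _
    rw [φ.eq_zero, Finset.sum_eq_zero]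
    intro p _
    rw [(localLength p).eq_zero]
    simp
  · intro q hq M _ _ _ hM e
    have hz : ∀ p ∈ F, p ≠ q →
        (((localLength p).toFun M).toNat : ℤ) * φ.toFun (R ⧸ p.asIdeal) = 0 := by
      intro p hp hpq
      rw [(localLength p).congr e, localLength_quotient_eq_zero]
      · simp
      · intro hqp
        exact hpq (hF p hp q hq hqp).symm
    rw [φ.congr e (by rwa [← e.support_eq])]
    by_cases hqF : q ∈ F
    · rw [Finset.sum_eq_single_of_mem q hqF hz, (localLength q).congr e,
        localLength_quotient_self]
      simp
    · rw [h0 q hq hqF, Finset.sum_eq_zero]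
      intro p hp
      exact hz p hp (by rintro rfl; exact hqF hp)
  · intro N M P _ _ _ _ _ _ _ _ _ f g h hN hP hf hg hfg ihN ihP
    rw [φ.eq_add f g h hf hg hfg, ihN, ihP, ← Finset.sum_add_distrib]
    refine Finset.sum_congr rfl fun p hp => ?_
    rw [(localLength p).eq_add f g hf hg hfg, ENat.toNat_add
      (localLength_ne_top_of_minimal (hF p hp) N hN) (localLength_ne_top_of_minimal (hF p hp) P hP)]
    push_cast
    ring

end Devissage

section Order

variable {S : Type u} [CommRing S]

/-- The order of vanishing of an element along a prime ideal. -/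
noncomputable def vanishingOrder (Q : PrimeSpectrum S) (a : S) : ℕ :=
  ((localLength Q).toFun (S ⧸ Ideal.span {a})).toNat

theorem vanishingOrder_eq_ord (Q : PrimeSpectrum S) (a : S) :
    vanishingOrder Q a = (Ring.ord (Localization.AtPrime Q.asIdeal)
      (algebraMap S (Localization.AtPrime Q.asIdeal) a)).toNat := by
  rw [vanishingOrder, localLength_quotient, Ideal.map_span, Set.image_singleton, Ring.ord]

variable [IsDomain S]

theorem isAtom_le {P Q : PrimeSpectrum S} (hQ : IsAtom Q) (hP : P ≤ Q) {a : S} (ha : a ≠ 0)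
    (haP : a ∈ P.asIdeal) : P = Q := by
  rcases hP.eq_or_lt with h | h
  · exact h
  · rw [hQ.2 P h] at haP
    exact absurd haP ha

variable [IsNoetherianRing S]

theorem finite_setOf_isAtom {a : S} (ha : a ≠ 0) :
    {Q : PrimeSpectrum S | IsAtom Q ∧ a ∈ Q.asIdeal}.Finite := by
  refine Set.Finite.of_finite_image (f := PrimeSpectrum.asIdeal)
    ((Ideal.span {a}).finite_minimalPrimes_of_isNoetherianRing.subset ?_)
    fun _ _ _ _ h => PrimeSpectrum.ext h
  rintro _ ⟨Q, ⟨hQ, haQ⟩, rfl⟩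
  refine ⟨⟨Q.isPrime, (Ideal.span_singleton_le_iff_mem _).2 haQ⟩, fun J hJ hJQ => ?_⟩
  have h := isAtom_le (P := ⟨J, hJ.1⟩) hQ hJQ ha
    ((Ideal.span_singleton_le_iff_mem _).1 hJ.2)
  exact le_of_eq (congrArg PrimeSpectrum.asIdeal h).symm

open scoped Classical in
/-- The prime ideals of height one that contain a nonzero element `a`. -/
noncomputable def heightOneSupport (a : S) : Finset (PrimeSpectrum S) :=
  if ha : a ≠ 0 then (finite_setOf_isAtom ha).toFinset else ∅

theorem mem_heightOneSupport {a : S} (ha : a ≠ 0) {Q : PrimeSpectrum S} :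
    Q ∈ heightOneSupport a ↔ IsAtom Q ∧ a ∈ Q.asIdeal := by
  simp [heightOneSupport, ha]

variable [IsIntegrallyClosed S]

theorem isDiscreteValuationRing_of_isAtom {Q : PrimeSpectrum S} (hQ : IsAtom Q) :
    IsDiscreteValuationRing (Localization.AtPrime Q.asIdeal) := by
  have hQ0 : Q.asIdeal ≠ ⊥ := fun h => hQ.1 (PrimeSpectrum.ext h)
  have hinj : Function.Injective (algebraMap S (Localization.AtPrime Q.asIdeal)) :=
    FaithfulSMul.algebraMap_injective _ _
  have hm : IsLocalRing.maximalIdeal (Localization.AtPrime Q.asIdeal) ≠ ⊥ := by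
    rw [← Localization.AtPrime.map_eq_maximalIdeal, Ne, Ideal.map_eq_bot_iff_of_injective hinj]
    exact hQ0
  have hf : ¬ IsField (Localization.AtPrime Q.asIdeal) :=
    IsLocalRing.isField_iff_maximalIdeal_eq.not.2 hm
  have : IsIntegrallyClosed (Localization.AtPrime Q.asIdeal) :=
    isIntegrallyClosed_of_isLocalization _ Q.asIdeal.primeCompl Q.asIdeal.primeCompl_le_nonZeroDivisors
  have h03 := (IsDiscreteValuationRing.TFAE _ hf).out 0 3
  refine h03.2 ⟨this, _, ⟨hm, inferInstance⟩, ?_⟩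
  rintro P ⟨hP0, hP⟩
  have hc : (P.comap (algebraMap S (Localization.AtPrime Q.asIdeal))) ≤ Q.asIdeal :=
    (Ideal.comap_mono (IsLocalRing.le_maximalIdeal hP.ne_top)).trans
      (le_of_eq Localization.AtPrime.under_maximalIdeal)
  have hne : (P.comap (algebraMap S (Localization.AtPrime Q.asIdeal))) ≠ ⊥ := by
    intro h
    apply hP0
    rw [← IsLocalization.map_under Q.asIdeal.primeCompl (Localization.AtPrime Q.asIdeal) P]
    change Ideal.map _ (P.comap _) = _
    rw [h, Ideal.map_bot]
  obtain ⟨a, ha, ha0⟩ := Submodule.exists_mem_ne_zero_of_ne_bot hne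
  have h := isAtom_le (P := ⟨_, hP.comap (algebraMap S (Localization.AtPrime Q.asIdeal))⟩)
    hQ hc ha0 ha
  rw [← IsLocalization.map_under Q.asIdeal.primeCompl (Localization.AtPrime Q.asIdeal) P,
    ← Localization.AtPrime.map_eq_maximalIdeal]
  exact congrArg (Ideal.map _) (congrArg PrimeSpectrum.asIdeal h)

variable {Q : PrimeSpectrum S} (hQ : IsAtom Q)

include hQ

theorem vanishingOrder_cast {a : S} (ha : a ≠ 0) :
    (vanishingOrder Q a : ℕ∞) = Ring.ord (Localization.AtPrime Q.asIdeal)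
      (algebraMap S (Localization.AtPrime Q.asIdeal) a) := by
  have := isDiscreteValuationRing_of_isAtom hQ
  rw [vanishingOrder_eq_ord]
  refine ENat.natCast_toNat ?_
  rw [Ring.ord_eq_addVal, Ne, IsDiscreteValuationRing.addVal_eq_top_iff]
  exact fun h => ha (FaithfulSMul.algebraMap_injective S (Localization.AtPrime Q.asIdeal)
    (h.trans (map_zero _).symm))

theorem vanishingOrder_mul {a b : S} (ha : a ≠ 0) (hb : b ≠ 0) :
    vanishingOrder Q (a * b) = vanishingOrder Q a + vanishingOrder Q b := by
  have := isDiscreteValuationRing_of_isAtom hQ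
  have h : (vanishingOrder Q (a * b) : ℕ∞) = vanishingOrder Q a + vanishingOrder Q b := by
    rw [vanishingOrder_cast hQ ha, vanishingOrder_cast hQ hb,
      vanishingOrder_cast hQ (mul_ne_zero ha hb), map_mul]
    simp
  exact_mod_cast h

theorem vanishingOrder_one : vanishingOrder Q (1 : S) = 0 := by
  have h := vanishingOrder_mul hQ (one_ne_zero (α := S)) one_ne_zero
  rw [mul_one] at h
  omega

theorem vanishingOrder_pow {a : S} (ha : a ≠ 0) (n : ℕ) :
    vanishingOrder Q (a ^ n) = n * vanishingOrder Q a := by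
  induction n with
  | zero => simp [vanishingOrder_one hQ]
  | succ n ih => rw [pow_succ, vanishingOrder_mul hQ (pow_ne_zero _ ha) ha, ih]; ring

theorem vanishingOrder_prod {ι : Type*} (s : Finset ι) (f : ι → S) (hf : ∀ i ∈ s, f i ≠ 0) :
    vanishingOrder Q (∏ i ∈ s, f i) = ∑ i ∈ s, vanishingOrder Q (f i) := by
  classical
  induction s using Finset.induction_on with
  | empty => simp [vanishingOrder_one hQ]
  | insert i s hi ih =>
    rw [Finset.prod_insert hi, Finset.sum_insert hi, vanishingOrder_mul hQ, ih]
    · exact fun j hj => hf j (Finset.mem_insert_of_mem hj)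
    · exact hf i (Finset.mem_insert_self _ _)
    · exact Finset.prod_ne_zero_iff.2 fun j hj => hf j (Finset.mem_insert_of_mem hj)

theorem vanishingOrder_eq_zero_iff {a : S} (ha : a ≠ 0) :
    vanishingOrder Q a = 0 ↔ a ∉ Q.asIdeal := by
  have := isDiscreteValuationRing_of_isAtom hQ
  rw [← Nat.cast_inj (R := ℕ∞), vanishingOrder_cast hQ ha, Nat.cast_zero, Ring.ord_eq_addVal,
    IsDiscreteValuationRing.addVal_eq_zero_iff,
    IsLocalization.AtPrime.isUnit_to_map_iff _ Q.asIdeal]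
  rfl

theorem exists_mul_eq_mul {a b : S} (ha : a ≠ 0) (hb : b ≠ 0)
    (h : vanishingOrder Q a = vanishingOrder Q b) :
    ∃ r s, r ∉ Q.asIdeal ∧ s ∉ Q.asIdeal ∧ r * a = s * b := by
  have := isDiscreteValuationRing_of_isAtom hQ
  rw [← Nat.cast_inj (R := ℕ∞), vanishingOrder_cast hQ ha, vanishingOrder_cast hQ hb,
    Ring.ord_eq_iff_associated] at h
  obtain ⟨e, he⟩ := h
  obtain ⟨s, t, hst⟩ := IsLocalization.exists_mk'_eq Q.asIdeal.primeCompl (e : Localization.AtPrime Q.asIdeal)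
  have hs : s ∉ Q.asIdeal := by
    have := e.isUnit
    rw [← hst, IsLocalization.AtPrime.isUnit_mk'_iff _ Q.asIdeal] at this
    exact this
  refine ⟨s, t, hs, t.2, ?_⟩
  apply FaithfulSMul.algebraMap_injective S (Localization.AtPrime Q.asIdeal)
  rw [map_mul, map_mul, ← he, ← hst, mul_left_comm, IsLocalization.mk'_spec', mul_comm]

theorem exists_vanishingOrder_eq_one (F : Finset (PrimeSpectrum S)) (hF : ∀ P ∈ F, IsAtom P) :
    ∃ t : S, t ≠ 0 ∧ vanishingOrder Q t = 1 ∧ ∀ P ∈ F, P ≠ Q → t ∉ P.asIdeal := by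
  classical
  have := isDiscreteValuationRing_of_isAtom hQ
  have hQ0 : Q.asIdeal ≠ ⊥ := fun h => hQ.1 (PrimeSpectrum.ext h)
  obtain ⟨ϖ, hϖ⟩ := IsDiscreteValuationRing.exists_irreducible (Localization.AtPrime Q.asIdeal)
  let I : Ideal S := (Ideal.span {ϖ ^ 2}).comap (algebraMap S (Localization.AtPrime Q.asIdeal))
  obtain ⟨s, d, hsd⟩ := IsLocalization.exists_mk'_eq Q.asIdeal.primeCompl ϖ
  have hsϖ : algebraMap S (Localization.AtPrime Q.asIdeal) s =
      algebraMap S (Localization.AtPrime Q.asIdeal) d * ϖ := by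
    rw [← hsd, IsLocalization.mk'_spec']
  have hdu : IsUnit (algebraMap S (Localization.AtPrime Q.asIdeal) d) :=
    (IsLocalization.AtPrime.isUnit_to_map_iff _ Q.asIdeal _).2 d.2
  have hs0 : s ≠ 0 := by
    rintro rfl
    rw [map_zero] at hsϖ
    exact mul_ne_zero hdu.ne_zero hϖ.ne_zero hsϖ.symm
  have hvs : vanishingOrder Q s = 1 := by
    rw [← Nat.cast_inj (R := ℕ∞), vanishingOrder_cast hQ hs0, hsϖ,
      Ring.ord_mul_of_isUnit_left hdu, Ring.ord_of_irreducible hϖ, Nat.cast_one]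
  have hsQ : s ∈ Q.asIdeal := by
    by_contra h
    rw [← vanishingOrder_eq_zero_iff hQ hs0] at h
    omega
  have hsI : s ∉ I := by
    intro h
    have h2 : ϖ ^ 2 ∣ ϖ := by
      have := Ideal.mem_span_singleton.1 (Ideal.mem_comap.1 h)
      rw [hsϖ] at this
      exact hdu.dvd_mul_left.1 this
    have h3 : ϖ * ϖ ∣ ϖ * 1 := by rwa [← pow_two, mul_one]
    exact hϖ.not_isUnit (isUnit_of_dvd_one ((mul_dvd_mul_iff_left hϖ.ne_zero).1 h3))
  have hcov : ¬ ((Q.asIdeal : Set S) ⊆ ⋃ i ∈ (↑(insert none ((F.erase Q).image some)) :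
      Set (Option (PrimeSpectrum S))), ((i.elim I PrimeSpectrum.asIdeal : Ideal S) : Set S)) := by
    rw [Ideal.subset_union_prime none none]
    · rintro ⟨i, hi, hQi⟩
      rcases i with _ | P
      · exact hsI (hQi hsQ)
      · simp only [Finset.mem_insert, reduceCtorEq, Finset.mem_image, Finset.mem_erase,
          Option.some.injEq, exists_eq_right, false_or] at hi
        have hle : Q ≤ P := hQi
        exact hi.1 (isAtom_le (hF P hi.2) hle hs0 hsQ).symm
    · intro i hi h1 _
      rcases i with _ | P
      · exact absurd rfl h1
      · exact P.isPrime
  rw [Set.not_subset] at hcov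
  obtain ⟨t, htQ, ht⟩ := hcov
  simp only [Set.mem_iUnion, not_exists] at ht
  have htI : t ∉ I := ht none (by simp)
  have ht0 : t ≠ 0 := by rintro rfl; exact htI (zero_mem _)
  refine ⟨t, ht0, ?_, fun P hP hPQ => ht (some P) (by simp [hP, hPQ])⟩
  have h1 : vanishingOrder Q t ≠ 0 := fun h => (vanishingOrder_eq_zero_iff hQ ht0).1 h htQ
  have h2 : ¬ 2 ≤ vanishingOrder Q t := by
    intro h
    apply htI
    refine Ideal.mem_comap.2 (Ideal.mem_span_singleton.2 ?_)
    rw [← IsDiscreteValuationRing.addVal_le_iff_dvd, IsDiscreteValuationRing.addVal_pow,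
      IsDiscreteValuationRing.addVal_uniformizer hϖ, ← Ring.ord_eq_addVal,
      ← vanishingOrder_cast hQ ht0]
    simpa using (Nat.cast_le (α := ℕ∞)).2 h
  omega

end Order

section PrimeQuotient

variable {R : Type u} [CommRing R] (l : LengthFunction R)

/-- The length of `R / (Q, s)`, as an integer. -/
noncomputable def quotientLength (Q : PrimeSpectrum R) (s : R) : ℤ :=
  (l.toFun (R ⧸ (Q.asIdeal ⊔ Ideal.span {s}))).toNat

theorem herbrand_eq_quotientLength {Q : PrimeSpectrum R} {s : R} (hs : s ∉ Q.asIdeal) :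
    l.herbrand s (R ⧸ Q.asIdeal) = quotientLength l Q s :=
  l.herbrand_quotient fun _ hb => (Q.isPrime.mem_or_mem hb).resolve_left hs

theorem herbrandFinite_of_notMem {Q : PrimeSpectrum R} {s : R} (hs : s ∉ Q.asIdeal)
    (h : l.toFun (R ⧸ (Q.asIdeal ⊔ Ideal.span {s})) ≠ ⊤) :
    l.HerbrandFinite s (R ⧸ Q.asIdeal) :=
  l.herbrandFinite_quotient (fun _ hb => (Q.isPrime.mem_or_mem hb).resolve_left hs) h

theorem toFun_quotient_mul {Q : PrimeSpectrum R} {s t : R} (ht : t ∉ Q.asIdeal) :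
    l.toFun (R ⧸ (Q.asIdeal ⊔ Ideal.span {s * t})) =
      l.toFun (R ⧸ (Q.asIdeal ⊔ Ideal.span {s})) +
        l.toFun (R ⧸ (Q.asIdeal ⊔ Ideal.span {t})) := by
  have hf : Q.asIdeal ⊔ Ideal.span {s} ≤
      Submodule.comap (LinearMap.lsmul R R t) (Q.asIdeal ⊔ Ideal.span {s * t}) := by
    refine sup_le (fun x hx => ?_) ((Ideal.span_singleton_le_iff_mem _).2 ?_)
    · exact Ideal.mem_sup_left (Ideal.mul_mem_left _ t hx)
    · refine Ideal.mem_sup_right (Ideal.mem_span_singleton.2 ?_)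
      rw [mul_comm]
      rfl
  have hg : Q.asIdeal ⊔ Ideal.span {s * t} ≤ Q.asIdeal ⊔ Ideal.span {t} :=
    sup_le_sup le_rfl (Ideal.span_singleton_le_span_singleton.2 (dvd_mul_left t s))
  refine l.eq_add (Submodule.mapQ _ _ (LinearMap.lsmul R R t) hf) (Submodule.factor hg) ?_
    (Submodule.factor_surjective hg) ?_
  · rw [← LinearMap.ker_eq_bot, eq_bot_iff]
    intro x hx
    obtain ⟨x, rfl⟩ := Submodule.mkQ_surjective _ x
    have hx' : t * x ∈ Q.asIdeal ⊔ Ideal.span {s * t} := (Submodule.Quotient.mk_eq_zero _).1 hx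
    obtain ⟨y, c, hc, h⟩ := Ideal.mem_span_singleton_sup.1 (sup_comm Q.asIdeal _ ▸ hx')
    refine (Submodule.Quotient.mk_eq_zero _).2 ?_
    rw [sup_comm]
    refine Ideal.mem_span_singleton_sup.2 ⟨y, x - y * s, ?_, by ring⟩
    refine (Q.isPrime.mem_or_mem (x := t) ?_).resolve_left ht
    have : t * (x - y * s) = c := by linear_combination -h
    rw [this]
    exact hc
  · intro x
    obtain ⟨x, rfl⟩ := Submodule.mkQ_surjective _ x
    constructor
    · intro hx
      have hx' : x ∈ Q.asIdeal ⊔ Ideal.span {t} := (Submodule.Quotient.mk_eq_zero _).1 hx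
      obtain ⟨y, c, hc, h⟩ := Ideal.mem_span_singleton_sup.1 (sup_comm Q.asIdeal _ ▸ hx')
      refine ⟨Submodule.mkQ _ y, ?_⟩
      refine (Submodule.Quotient.eq _).2 (Ideal.mem_sup_left ?_)
      have : t • y - x = -c := by rw [smul_eq_mul]; linear_combination h
      change t • y - x ∈ _
      rw [this]
      exact neg_mem hc
    · rintro ⟨y, hy⟩
      obtain ⟨y, rfl⟩ := Submodule.mkQ_surjective _ y
      rw [← hy]
      refine (Submodule.Quotient.mk_eq_zero _).2 (Ideal.mem_sup_right ?_)
      exact Ideal.mul_mem_right _ _ (Ideal.mem_span_singleton_self t)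

/-- The kernel of `a` on `R / b` is isomorphic to the kernel of `b` on `R / a`. -/
theorem toFun_ker_comm {R : Type u} [CommRing R] [IsDomain R] (l : LengthFunction R) {a b : R}
    (ha : a ≠ 0) (hb : b ≠ 0) :
    l.toFun (LinearMap.ker (LinearMap.lsmul R (R ⧸ Ideal.span {b}) a)) =
      l.toFun (LinearMap.ker (LinearMap.lsmul R (R ⧸ Ideal.span {a}) b)) := by
  let K : Submodule R (R × R) :=
    LinearMap.ker ((LinearMap.lsmul R R a).comp (LinearMap.fst R R R) -
      (LinearMap.lsmul R R b).comp (LinearMap.snd R R R))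
  have hK : ∀ x : K, a * x.1.1 = b * x.1.2 := fun x =>
    sub_eq_zero.1 (LinearMap.mem_ker.1 x.2)
  let f : K →ₗ[R] LinearMap.ker (LinearMap.lsmul R (R ⧸ Ideal.span {b}) a) :=
    (((Ideal.span {b} : Submodule R R).mkQ.comp (LinearMap.fst R R R)).comp K.subtype).codRestrict _
      fun x => (Submodule.Quotient.mk_eq_zero _).2 (Ideal.mem_span_singleton.2 ⟨x.1.2, hK x⟩)
  let g : K →ₗ[R] LinearMap.ker (LinearMap.lsmul R (R ⧸ Ideal.span {a}) b) :=
    (((Ideal.span {a} : Submodule R R).mkQ.comp (LinearMap.snd R R R)).comp K.subtype).codRestrict _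
      fun x => (Submodule.Quotient.mk_eq_zero _).2
        (Ideal.mem_span_singleton.2 ⟨x.1.1, (hK x).symm⟩)
  have hf : Function.Surjective f := by
    rintro ⟨x, hx⟩
    obtain ⟨x, rfl⟩ := Submodule.mkQ_surjective _ x
    obtain ⟨y, hy⟩ := Ideal.mem_span_singleton.1 ((Submodule.Quotient.mk_eq_zero _).1 hx)
    exact ⟨⟨(x, y), by simpa [K, sub_eq_zero] using hy⟩, rfl⟩
  have hg : Function.Surjective g := by
    rintro ⟨x, hx⟩
    obtain ⟨x, rfl⟩ := Submodule.mkQ_surjective _ x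
    obtain ⟨y, hy⟩ := Ideal.mem_span_singleton.1 ((Submodule.Quotient.mk_eq_zero _).1 hx)
    exact ⟨⟨(y, x), by simpa [K, sub_eq_zero] using hy.symm⟩, rfl⟩
  have hker : LinearMap.ker f = LinearMap.ker g := by
    ext x
    have h1 : x ∈ LinearMap.ker f ↔ x.1.1 ∈ Ideal.span {b} :=
      Subtype.ext_iff.trans (Submodule.Quotient.mk_eq_zero _)
    have h2 : x ∈ LinearMap.ker g ↔ x.1.2 ∈ Ideal.span {a} :=
      Subtype.ext_iff.trans (Submodule.Quotient.mk_eq_zero _)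
    rw [h1, h2, Ideal.mem_span_singleton, Ideal.mem_span_singleton]
    have h := hK x
    constructor
    · rintro ⟨c, hc⟩
      refine ⟨c, mul_left_cancel₀ hb ?_⟩
      rw [← h, hc]
      ring
    · rintro ⟨c, hc⟩
      refine ⟨c, mul_left_cancel₀ ha ?_⟩
      rw [h, hc]
      ring
  rw [← l.congr (f.quotKerEquivOfSurjective hf), ← l.congr (g.quotKerEquivOfSurjective hg), hker]

theorem herbrand_comm {R : Type u} [CommRing R] [IsDomain R] (l : LengthFunction R) {a b : R}
    (ha : a ≠ 0) (hb : b ≠ 0) :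
    l.herbrand a (R ⧸ Ideal.span {b}) = l.herbrand b (R ⧸ Ideal.span {a}) := by
  rw [LengthFunction.herbrand, LengthFunction.herbrand, toFun_ker_comm l ha hb,
    l.congr (LengthFunction.quotientRangeEquiv (Ideal.span {b}) a),
    l.congr (LengthFunction.quotientRangeEquiv (Ideal.span {a}) b), sup_comm]

end PrimeQuotient

section TameSymbol

variable {S : Type u} [CommRing S] [IsDomain S] (l : LengthFunction S)

open scoped Classical in
/-- The length of the divisor of the tame symbol `a ^ v(b) / b ^ v(a)` of `a` and `b` at a prime
ideal of height one: if `r * a ^ v(b) = s * b ^ v(a)`, it is the difference of the lengths of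
`S / (Q, s)` and `S / (Q, r)`. -/
noncomputable def tameLength (Q : PrimeSpectrum S) (a b : S) : ℤ :=
  if h : IsAtom Q ∧ ∃ rs : S × S, rs.1 ∉ Q.asIdeal ∧ rs.2 ∉ Q.asIdeal ∧
      rs.1 * a ^ vanishingOrder Q b = rs.2 * b ^ vanishingOrder Q a then
    quotientLength l Q h.2.choose.2 - quotientLength l Q h.2.choose.1
  else 0

/-- The sum over all prime ideals of height one of the lengths of the divisors of the tame
symbols. -/
noncomputable def tameSum (a b : S) : ℤ :=
  ∑ᶠ Q : PrimeSpectrum S, tameLength l Q a b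

variable [IsNoetherianRing S]

theorem exists_tame [IsIntegrallyClosed S] {Q : PrimeSpectrum S} (hQ : IsAtom Q) {a b : S} (ha : a ≠ 0) (hb : b ≠ 0) :
    ∃ r s, r ∉ Q.asIdeal ∧ s ∉ Q.asIdeal ∧
      r * a ^ vanishingOrder Q b = s * b ^ vanishingOrder Q a := by
  refine exists_mul_eq_mul hQ (pow_ne_zero _ ha) (pow_ne_zero _ hb) ?_
  rw [vanishingOrder_pow hQ ha, vanishingOrder_pow hQ hb, mul_comm]

variable (hl : ∀ P : PrimeSpectrum S, P ≠ ⊥ → ¬ IsAtom P → l.toFun (S ⧸ P.asIdeal) ≠ ⊤)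

include hl

theorem toFun_quotient_ne_top {Q : PrimeSpectrum S} (hQ : IsAtom Q) {s : S} (hs : s ∉ Q.asIdeal) :
    l.toFun (S ⧸ (Q.asIdeal ⊔ Ideal.span {s})) ≠ ⊤ := by
  refine l.ne_top_of_support (C := Module.support S (S ⧸ (Q.asIdeal ⊔ Ideal.span {s})))
    (fun P hP => ?_) _ subset_rfl
  rw [mem_support_quotient] at hP
  have hlt : Q < P := by
    refine lt_of_le_of_ne (le_sup_left.trans hP) ?_
    rintro rfl
    exact hs (hP (Ideal.mem_sup_right (Ideal.mem_span_singleton_self s)))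
  refine hl P (ne_bot_of_gt hlt) fun hPa => ?_
  exact hQ.1 (hPa.2 Q hlt)

theorem quotientLength_mul {Q : PrimeSpectrum S} (hQ : IsAtom Q) {s t : S} (hs : s ∉ Q.asIdeal)
    (ht : t ∉ Q.asIdeal) :
    quotientLength l Q (s * t) = quotientLength l Q s + quotientLength l Q t := by
  rw [quotientLength, toFun_quotient_mul l ht, ENat.toNat_add (toFun_quotient_ne_top l hl hQ hs)
    (toFun_quotient_ne_top l hl hQ ht), Nat.cast_add]
  rfl

theorem quotientLength_one {Q : PrimeSpectrum S} (hQ : IsAtom Q) : quotientLength l Q 1 = 0 := by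
  have h1 : (1 : S) ∉ Q.asIdeal := (Ideal.ne_top_iff_one _).1 Q.isPrime.ne_top
  have h := quotientLength_mul l hl hQ h1 h1
  rw [mul_one] at h
  omega

theorem quotientLength_pow {Q : PrimeSpectrum S} (hQ : IsAtom Q) {s : S} (hs : s ∉ Q.asIdeal)
    (n : ℕ) : quotientLength l Q (s ^ n) = n * quotientLength l Q s := by
  induction n with
  | zero => simp [quotientLength_one l hl hQ]
  | succ n ih =>
    rw [pow_succ, quotientLength_mul l hl hQ (fun h => hs (Q.isPrime.mem_of_pow_mem _ h)) hs, ih]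
    push_cast
    ring

theorem tameLength_eq {Q : PrimeSpectrum S} (hQ : IsAtom Q) {a b r s : S} (ha : a ≠ 0)
    (hb : b ≠ 0) (hr : r ∉ Q.asIdeal) (hs : s ∉ Q.asIdeal)
    (h : r * a ^ vanishingOrder Q b = s * b ^ vanishingOrder Q a) :
    tameLength l Q a b = quotientLength l Q s - quotientLength l Q r := by
  have hex : IsAtom Q ∧ ∃ rs : S × S, rs.1 ∉ Q.asIdeal ∧ rs.2 ∉ Q.asIdeal ∧
      rs.1 * a ^ vanishingOrder Q b = rs.2 * b ^ vanishingOrder Q a := ⟨hQ, (r, s), hr, hs, h⟩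
  rw [tameLength, dif_pos hex]
  obtain ⟨h1, h2, h3⟩ := hex.2.choose_spec
  generalize hex.2.choose = rs at h1 h2 h3
  have h4 : r * rs.2 = s * rs.1 := by
    have hab : a ^ vanishingOrder Q b * b ^ vanishingOrder Q a ≠ 0 :=
      mul_ne_zero (pow_ne_zero _ ha) (pow_ne_zero _ hb)
    apply mul_right_cancel₀ hab
    linear_combination rs.2 * b ^ vanishingOrder Q a * h - s * b ^ vanishingOrder Q a * h3
  have h5 := quotientLength_mul l hl hQ hr h2
  rw [h4, quotientLength_mul l hl hQ hs h1] at h5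
  omega

theorem herbrand_eq_sum {a b : S} (hb : b ≠ 0)
    (hab : ∀ Q : PrimeSpectrum S, IsAtom Q → b ∈ Q.asIdeal → a ∉ Q.asIdeal) :
    l.herbrand a (S ⧸ Ideal.span {b}) =
      ∑ Q ∈ heightOneSupport b, vanishingOrder Q b * quotientLength l Q a := by
  have hC : ∀ P ∈ {P : PrimeSpectrum S | b ∈ P.asIdeal}, l.HerbrandFinite a (S ⧸ P.asIdeal) := by
    intro P hP
    by_cases hPa : IsAtom P
    · exact herbrandFinite_of_notMem l (hab P hPa hP)
        (toFun_quotient_ne_top l hl hPa (hab P hPa hP))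
    · refine l.herbrandFinite_of_ne_top _ (hl P ?_ hPa)
      rintro rfl
      exact hb hP
  have h := (l.herbrandAdditiveOn a hC).eq_sum (heightOneSupport b) ?_ ?_ (S ⧸ Ideal.span {b}) ?_
  · refine h.trans (Finset.sum_congr rfl fun Q hQ => ?_)
    rw [mem_heightOneSupport hb] at hQ
    exact congrArg _ (herbrand_eq_quotientLength l (hab Q hQ.1 hQ.2))
  · intro P hP Q hQ hQP
    rw [mem_heightOneSupport hb] at hP
    exact isAtom_le hP.1 hQP hb hQ
  · intro P hP hPF
    rw [mem_heightOneSupport hb] at hPF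
    refine l.herbrand_eq_zero _ (hl P ?_ fun h => hPF ⟨h, hP⟩)
    rintro rfl
    exact hb hP
  · intro P hP
    rw [mem_support_quotient] at hP
    exact hP (Ideal.mem_span_singleton_self b)

variable [IsIntegrallyClosed S]

theorem tameLength_mul_left (Q : PrimeSpectrum S) {a a' b : S} (ha : a ≠ 0) (ha' : a' ≠ 0)
    (hb : b ≠ 0) : tameLength l Q (a * a') b = tameLength l Q a b + tameLength l Q a' b := by
  by_cases hQ : IsAtom Q
  · obtain ⟨r, s, hr, hs, h⟩ := exists_tame hQ ha hb
    obtain ⟨r', s', hr', hs', h'⟩ := exists_tame hQ ha' hb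
    have key : (r * r') * (a * a') ^ vanishingOrder Q b =
        (s * s') * b ^ vanishingOrder Q (a * a') := by
      rw [vanishingOrder_mul hQ ha ha', mul_pow, pow_add]
      linear_combination r' * a' ^ vanishingOrder Q b * h + s * b ^ vanishingOrder Q a * h'
    rw [tameLength_eq l hl hQ ha hb hr hs h, tameLength_eq l hl hQ ha' hb hr' hs' h',
      tameLength_eq l hl hQ (mul_ne_zero ha ha') hb
        (fun h => (Q.isPrime.mem_or_mem h).elim hr hr')
        (fun h => (Q.isPrime.mem_or_mem h).elim hs hs') key,
      quotientLength_mul l hl hQ hr hr', quotientLength_mul l hl hQ hs hs']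
    ring
  · simp [tameLength, hQ]

theorem tameLength_swap (Q : PrimeSpectrum S) {a b : S} (ha : a ≠ 0) (hb : b ≠ 0) :
    tameLength l Q b a = - tameLength l Q a b := by
  by_cases hQ : IsAtom Q
  · obtain ⟨r, s, hr, hs, h⟩ := exists_tame hQ ha hb
    rw [tameLength_eq l hl hQ ha hb hr hs h, tameLength_eq l hl hQ hb ha hs hr h.symm]
    ring
  · simp [tameLength, hQ]

theorem tameLength_of_notMem_left {Q : PrimeSpectrum S} (hQ : IsAtom Q) {a b : S} (ha : a ≠ 0)
    (hb : b ≠ 0) (haQ : a ∉ Q.asIdeal) :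
    tameLength l Q a b = vanishingOrder Q b * quotientLength l Q a := by
  have h1 : (1 : S) ∉ Q.asIdeal := (Ideal.ne_top_iff_one _).1 Q.isPrime.ne_top
  rw [tameLength_eq l hl hQ ha hb (r := 1) (s := a ^ vanishingOrder Q b) h1
    (fun h => haQ (Q.isPrime.mem_of_pow_mem _ h)), quotientLength_pow l hl hQ haQ,
    quotientLength_one l hl hQ, sub_zero]
  rw [(vanishingOrder_eq_zero_iff hQ ha).2 haQ]
  ring

theorem support_tameLength_subset {a b : S} (ha : a ≠ 0) (hb : b ≠ 0) :
    Function.support (fun Q => tameLength l Q a b) ⊆ (heightOneSupport (a * b) : Set _) := by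
  intro Q h
  rw [Finset.mem_coe, mem_heightOneSupport (mul_ne_zero ha hb)]
  have hQ : IsAtom Q := by
    by_contra hQ
    exact h (by simp [tameLength, hQ])
  refine ⟨hQ, ?_⟩
  by_contra hab
  refine h ?_
  have hbQ : b ∉ Q.asIdeal := fun h => hab (Ideal.mul_mem_left _ _ h)
  change tameLength l Q a b = 0
  rw [tameLength_of_notMem_left l hl hQ ha hb fun h => hab (Ideal.mul_mem_right _ _ h),
    (vanishingOrder_eq_zero_iff hQ hb).2 hbQ]
  simp

theorem finite_support_tameLength {a b : S} (ha : a ≠ 0) (hb : b ≠ 0) :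
    (Function.support (fun Q => tameLength l Q a b)).Finite :=
  (heightOneSupport (a * b)).finite_toSet.subset (support_tameLength_subset l hl ha hb)

theorem tameSum_mul_left {a a' b : S} (ha : a ≠ 0) (ha' : a' ≠ 0) (hb : b ≠ 0) :
    tameSum l (a * a') b = tameSum l a b + tameSum l a' b := by
  rw [tameSum, tameSum, tameSum, ← finsum_add_distrib (finite_support_tameLength l hl ha hb)
    (finite_support_tameLength l hl ha' hb)]
  exact finsum_congr fun Q => tameLength_mul_left l hl Q ha ha' hb

theorem tameSum_swap {a b : S} (ha : a ≠ 0) (hb : b ≠ 0) :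
    tameSum l b a = - tameSum l a b := by
  rw [tameSum, tameSum, ← finsum_neg_distrib]
  exact finsum_congr fun Q => tameLength_swap l hl Q ha hb

theorem tameSum_eq_zero_of_coprime {a b : S} (ha : a ≠ 0) (hb : b ≠ 0)
    (hab : ∀ Q : PrimeSpectrum S, IsAtom Q → b ∈ Q.asIdeal → a ∉ Q.asIdeal) :
    tameSum l a b = 0 := by
  classical
  have h : tameSum l a b = ∑ Q ∈ heightOneSupport b ∪ heightOneSupport a, tameLength l Q a b := by
    refine finsum_eq_sum_of_support_subset _
      ((support_tameLength_subset l hl ha hb).trans fun Q hQ => ?_)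
    rw [Finset.mem_coe, mem_heightOneSupport (mul_ne_zero ha hb)] at hQ
    rw [Finset.mem_coe, Finset.mem_union, mem_heightOneSupport ha, mem_heightOneSupport hb]
    have := Q.isPrime.mem_or_mem hQ.2
    tauto
  rw [h, Finset.sum_union, Finset.sum_congr (s₁ := heightOneSupport b)
      (g := fun Q => vanishingOrder Q b * quotientLength l Q a) rfl,
    Finset.sum_congr (s₁ := heightOneSupport a)
      (g := fun Q => - (vanishingOrder Q a * quotientLength l Q b)) rfl,
    Finset.sum_neg_distrib, ← herbrand_eq_sum l hl hb hab,
    ← herbrand_eq_sum l hl ha fun Q hQ h h' => hab Q hQ h' h, herbrand_comm l ha hb, add_neg_cancel]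
  · intro Q hQ
    rw [mem_heightOneSupport ha] at hQ
    rw [tameLength_swap l hl Q hb ha,
      tameLength_of_notMem_left l hl hQ.1 hb ha fun h => hab Q hQ.1 h hQ.2]
  · intro Q hQ
    rw [mem_heightOneSupport hb] at hQ
    exact tameLength_of_notMem_left l hl hQ.1 ha hb (hab Q hQ.1 hQ.2)
  · rw [Finset.disjoint_left]
    intro Q hQ hQ'
    rw [mem_heightOneSupport hb] at hQ
    rw [mem_heightOneSupport ha] at hQ'
    exact hab Q hQ.1 hQ.2 hQ'.2

theorem tameSum_congr_left {a a' b : S} (ha : a ≠ 0) (ha' : a' ≠ 0) (hb : b ≠ 0)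
    (h : ∀ Q : PrimeSpectrum S, IsAtom Q → b ∈ Q.asIdeal →
      vanishingOrder Q a = vanishingOrder Q a') : tameSum l a b = tameSum l a' b := by
  let I : Ideal S := Submodule.comap (LinearMap.lsmul S S a') (Ideal.span {a})
  have hcov : ¬ ((I : Set S) ⊆ ⋃ Q ∈ (heightOneSupport b : Set (PrimeSpectrum S)), Q.asIdeal) := by
    rw [Ideal.subset_union_prime ⊥ ⊥ fun Q _ _ _ => Q.isPrime]
    rintro ⟨Q, hQ, hIQ⟩
    rw [mem_heightOneSupport hb] at hQ
    obtain ⟨r, s, hr, hs, hrs⟩ := exists_mul_eq_mul hQ.1 ha ha' (h Q hQ.1 hQ.2)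
    refine hs (hIQ (Ideal.mem_span_singleton.2 ⟨r, ?_⟩))
    simp only [LinearMap.lsmul_apply, smul_eq_mul]
    linear_combination -hrs
  rw [Set.not_subset] at hcov
  obtain ⟨r, hrI, hr⟩ := hcov
  simp only [Set.mem_iUnion, not_exists] at hr
  have hr' : ∀ Q : PrimeSpectrum S, IsAtom Q → b ∈ Q.asIdeal → r ∉ Q.asIdeal := fun Q hQ hbQ =>
    hr Q ((mem_heightOneSupport hb).2 ⟨hQ, hbQ⟩)
  obtain ⟨s, hs⟩ := Ideal.mem_span_singleton.1 hrI
  simp only [LinearMap.lsmul_apply, smul_eq_mul] at hs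
  by_cases hr0 : r = 0
  · have hb' : ∀ Q : PrimeSpectrum S, IsAtom Q → b ∉ Q.asIdeal := fun Q hQ hbQ =>
      hr' Q hQ hbQ (hr0 ▸ zero_mem _)
    rw [tameSum_eq_zero_of_coprime l hl ha hb fun Q hQ hbQ => absurd hbQ (hb' Q hQ),
      tameSum_eq_zero_of_coprime l hl ha' hb fun Q hQ hbQ => absurd hbQ (hb' Q hQ)]
  have hs0 : s ≠ 0 := by
    rintro rfl
    rw [mul_zero] at hs
    exact mul_ne_zero ha' hr0 hs
  have hs' : ∀ Q : PrimeSpectrum S, IsAtom Q → b ∈ Q.asIdeal → s ∉ Q.asIdeal := by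
    intro Q hQ hbQ
    rw [← vanishingOrder_eq_zero_iff hQ hs0]
    have h1 := vanishingOrder_mul hQ ha' hr0
    have h2 := vanishingOrder_mul hQ ha hs0
    have h3 := h Q hQ hbQ
    have h4 := (vanishingOrder_eq_zero_iff hQ hr0).2 (hr' Q hQ hbQ)
    rw [hs] at h1
    omega
  have h1 := tameSum_mul_left l hl ha' hr0 hb
  rw [hs, tameSum_mul_left l hl ha hs0 hb, tameSum_eq_zero_of_coprime l hl hs0 hb hs',
    tameSum_eq_zero_of_coprime l hl hr0 hb hr'] at h1
  simpa using h1

theorem tameSum_prod_left {ι : Type*} (s : Finset ι) (f : ι → S) {b : S}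
    (hf : ∀ i ∈ s, f i ≠ 0) (hb : b ≠ 0) :
    tameSum l (∏ i ∈ s, f i) b = ∑ i ∈ s, tameSum l (f i) b := by
  classical
  induction s using Finset.induction_on with
  | empty =>
    rw [Finset.prod_empty, Finset.sum_empty]
    refine tameSum_eq_zero_of_coprime l hl one_ne_zero hb fun Q _ _ => ?_
    exact (Ideal.ne_top_iff_one _).1 Q.isPrime.ne_top
  | insert i s hi ih =>
    have h1 := fun j hj => hf j (Finset.mem_insert_of_mem hj)
    rw [Finset.prod_insert hi, Finset.sum_insert hi,
      tameSum_mul_left l hl (hf i (Finset.mem_insert_self _ _)) (Finset.prod_ne_zero_iff.2 h1) hb,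
      ih h1]

theorem tameSum_pow_left {a b : S} (ha : a ≠ 0) (hb : b ≠ 0) (n : ℕ) :
    tameSum l (a ^ n) b = n * tameSum l a b := by
  have h := tameSum_prod_left l hl (Finset.range n) (fun _ => a) (fun _ _ => ha) hb
  simpa using h

theorem tameSum_congr_right {a b b' : S} (ha : a ≠ 0) (hb : b ≠ 0) (hb' : b' ≠ 0)
    (h : ∀ Q : PrimeSpectrum S, IsAtom Q → a ∈ Q.asIdeal →
      vanishingOrder Q b = vanishingOrder Q b') : tameSum l a b = tameSum l a b' := by
  rw [tameSum_swap l hl hb ha, tameSum_swap l hl hb' ha, tameSum_congr_left l hl hb hb' ha h]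

theorem tameSum_eq_zero_of_common_prime {Q : PrimeSpectrum S} (hQ : IsAtom Q) {t t' : S}
    (ht : t ≠ 0) (ht' : t' ≠ 0) (hv : vanishingOrder Q t = 1) (hv' : vanishingOrder Q t' = 1)
    (h : ∀ P : PrimeSpectrum S, IsAtom P → P ≠ Q → t ∈ P.asIdeal → t' ∉ P.asIdeal) :
    tameSum l t t' = 0 := by
  classical
  obtain ⟨z, hz, hvz, hzP⟩ := exists_vanishingOrder_eq_one hQ
    (heightOneSupport t ∪ heightOneSupport t') (fun P hP => by
      rw [Finset.mem_union, mem_heightOneSupport ht, mem_heightOneSupport ht'] at hP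
      tauto)
  have hzt : ∀ P : PrimeSpectrum S, IsAtom P → P ≠ Q → t ∈ P.asIdeal → z ∉ P.asIdeal :=
    fun P hP hPQ htP => hzP P (Finset.mem_union_left _ ((mem_heightOneSupport ht).2 ⟨hP, htP⟩)) hPQ
  have hzt' : ∀ P : PrimeSpectrum S, IsAtom P → P ≠ Q → t' ∈ P.asIdeal → z ∉ P.asIdeal :=
    fun P hP hPQ htP => hzP P (Finset.mem_union_right _ ((mem_heightOneSupport ht').2 ⟨hP, htP⟩)) hPQ
  have key : ∀ x y z : S, x ≠ 0 → y ≠ 0 → z ≠ 0 → vanishingOrder Q y = 1 →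
      vanishingOrder Q z = 1 →
      (∀ P : PrimeSpectrum S, IsAtom P → P ≠ Q → x ∈ P.asIdeal → y ∉ P.asIdeal) →
      (∀ P : PrimeSpectrum S, IsAtom P → P ≠ Q → x ∈ P.asIdeal → z ∉ P.asIdeal) →
      tameSum l x y = tameSum l x z := by
    intro x y z hx hy hz hvy hvz h1 h2
    refine tameSum_congr_right l hl hx hy hz fun P hP hxP => ?_
    by_cases hPQ : P = Q
    · rw [hPQ, hvy, hvz]
    · rw [(vanishingOrder_eq_zero_iff hP hy).2 (h1 P hP hPQ hxP),
        (vanishingOrder_eq_zero_iff hP hz).2 (h2 P hP hPQ hxP)]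
  have e1 := key t t' z ht ht' hz hv' hvz h hzt
  have e2 := key z t t' hz ht ht' hv hv' (fun P hP hPQ h1 h2 => hzt P hP hPQ h2 h1)
    (fun P hP hPQ h1 h2 => hzt' P hP hPQ h2 h1)
  have e3 := key t' z t ht' hz ht hvz hv hzt' (fun P hP hPQ h1 h2 => h P hP hPQ h2 h1)
  have s1 := tameSum_swap l hl ht hz
  have s2 := tameSum_swap l hl ht' hz
  have s3 := tameSum_swap l hl ht ht'
  omega

theorem tameSum_eq_zero_of_uniformizer {Q : PrimeSpectrum S} (hQ : IsAtom Q) {t b : S}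
    (ht : t ≠ 0) (hb : b ≠ 0) (hv : vanishingOrder Q t = 1)
    (h : ∀ P : PrimeSpectrum S, IsAtom P → P ≠ Q → b ∈ P.asIdeal → t ∉ P.asIdeal) :
    tameSum l t b = 0 := by
  obtain ⟨z, hz, hvz, hzP⟩ := exists_vanishingOrder_eq_one hQ (heightOneSupport t) (fun P hP =>
    ((mem_heightOneSupport ht).1 hP).1)
  have hzt : ∀ P : PrimeSpectrum S, IsAtom P → P ≠ Q → t ∈ P.asIdeal → z ∉ P.asIdeal :=
    fun P hP hPQ htP => hzP P ((mem_heightOneSupport ht).2 ⟨hP, htP⟩) hPQ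
  rw [tameSum_congr_right l hl ht hb (pow_ne_zero (vanishingOrder Q b) hz),
    tameSum_swap l hl (pow_ne_zero (vanishingOrder Q b) hz) ht, tameSum_pow_left l hl hz ht,
    tameSum_swap l hl ht hz, tameSum_eq_zero_of_common_prime l hl hQ ht hz hv hvz hzt]
  · simp
  · intro P hP htP
    rw [vanishingOrder_pow hP hz]
    by_cases hPQ : P = Q
    · rw [hPQ, hvz, mul_one]
    · rw [(vanishingOrder_eq_zero_iff hP hz).2 (hzt P hP hPQ htP),
        (vanishingOrder_eq_zero_iff hP hb).2 fun h' => h P hP hPQ h' htP, mul_zero]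

/-- Reciprocity: the divisors of the tame symbols of two elements add up to zero. -/
theorem tameSum_eq_zero {a b : S} (ha : a ≠ 0) (hb : b ≠ 0) : tameSum l a b = 0 := by
  have hF : ∀ P ∈ heightOneSupport b, IsAtom P := fun P hP => ((mem_heightOneSupport hb).1 hP).1
  have hex : ∀ Q : PrimeSpectrum S, ∃ t : S, IsAtom Q → t ≠ 0 ∧ vanishingOrder Q t = 1 ∧
      ∀ P ∈ heightOneSupport b, P ≠ Q → t ∉ P.asIdeal := by
    intro Q
    by_cases hQ : IsAtom Q
    · obtain ⟨t, ht⟩ := exists_vanishingOrder_eq_one hQ _ hF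
      exact ⟨t, fun _ => ht⟩
    · exact ⟨0, fun h => absurd h hQ⟩
  choose t ht using hex
  have hne : ∀ Q ∈ heightOneSupport b, t Q ^ vanishingOrder Q a ≠ 0 := fun Q hQ =>
    pow_ne_zero _ (ht Q (hF Q hQ)).1
  rw [tameSum_congr_left l hl ha (Finset.prod_ne_zero_iff.2 hne) hb, tameSum_prod_left l hl _ _ hne hb,
    Finset.sum_eq_zero]
  · intro Q hQ
    obtain ⟨h1, h2, h3⟩ := ht Q (hF Q hQ)
    rw [tameSum_pow_left l hl h1 hb, tameSum_eq_zero_of_uniformizer l hl (hF Q hQ) h1 hb h2,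
      mul_zero]
    exact fun P hP hPQ hbP => h3 P ((mem_heightOneSupport hb).2 ⟨hP, hbP⟩) hPQ
  · intro P hP hbP
    have hPm : P ∈ heightOneSupport b := (mem_heightOneSupport hb).2 ⟨hP, hbP⟩
    rw [vanishingOrder_prod hP _ _ hne, Finset.sum_eq_single_of_mem P hPm,
      vanishingOrder_pow hP (ht P hP).1, (ht P hP).2.1, mul_one]
    intro Q hQ hQP
    obtain ⟨h1, h2, h3⟩ := ht Q (hF Q hQ)
    rw [vanishingOrder_pow hP h1, (vanishingOrder_eq_zero_iff hP h1).2 (h3 P hPm hQP.symm),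
      mul_zero]

end TameSymbol

section Restrict

variable {A : Type u} [CommRing A] (l : LengthFunction A)

theorem herbrand_restrict_congr (S T : Type u) [CommRing S] [CommRing T] [Algebra A S]
    [Algebra A T] (M : Type u) [AddCommGroup M] [Module A M] [Module S M] [Module T M]
    [IsScalarTower A S M] [IsScalarTower A T M] {s : S} {t : T} (h : ∀ x : M, s • x = t • x) :
    (l.restrict S).herbrand s M = (l.restrict T).herbrand t M := by
  have hk : (LinearMap.ker (LinearMap.lsmul S M s)).restrictScalars A =
      (LinearMap.ker (LinearMap.lsmul T M t)).restrictScalars A := by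
    ext x
    simp [h]
  have hr : (LinearMap.range (LinearMap.lsmul S M s)).restrictScalars A =
      (LinearMap.range (LinearMap.lsmul T M t)).restrictScalars A := by
    ext x
    simp [h]
  have e1 : (l.restrict S).toFun (LinearMap.ker (LinearMap.lsmul S M s)) =
      (l.restrict T).toFun (LinearMap.ker (LinearMap.lsmul T M t)) := by
    rw [l.restrict_apply, l.restrict_apply]
    exact l.congr (LinearEquiv.ofEq _ _ hk)
  have e2 : (l.restrict S).toFun (M ⧸ LinearMap.range (LinearMap.lsmul S M s)) =
      (l.restrict T).toFun (M ⧸ LinearMap.range (LinearMap.lsmul T M t)) := by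
    rw [l.restrict_apply, l.restrict_apply]
    exact l.congr (((Submodule.Quotient.restrictScalarsEquiv A _).symm.trans
      (Submodule.quotEquivOfEq _ _ hr)).trans (Submodule.Quotient.restrictScalarsEquiv A _))
  rw [LengthFunction.herbrand, LengthFunction.herbrand, e1, e2]

theorem quotientLength_restrict_self (P : PrimeSpectrum A) (a : A) :
    quotientLength (l.restrict A) P a = quotientLength l P a := by
  rw [quotientLength, quotientLength, l.restrict_apply]

theorem toFun_eq_of_surjective {N : Type u} [AddCommGroup N] [Module A N] (f : A →ₗ[A] N)
    (hf : Function.Surjective f) {I : Ideal A} (hI : LinearMap.ker f = I) :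
    l.toFun N = l.toFun (A ⧸ I) := by
  rw [← l.congr (f.quotKerEquivOfSurjective hf), hI]

end Restrict

section Finite

variable {A : Type u} [CommRing A] {T : Type u} [CommRing T] [Algebra A T]

theorem support_quotient_subset (P : PrimeSpectrum T) :
    Module.support A (T ⧸ P.asIdeal) ⊆ {n | comap (algebraMap A T) P ≤ n} := by
  intro n hn a ha
  refine Module.annihilator_le_of_mem_support hn (Module.mem_annihilator.2 fun x => ?_)
  obtain ⟨x, rfl⟩ := Ideal.Quotient.mk_surjective x
  rw [← Ideal.Quotient.mk_eq_mk, ← Submodule.Quotient.mk_smul, Algebra.smul_def]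
  exact (Submodule.Quotient.mk_eq_zero _).2 (Ideal.mul_mem_right _ _ ha)

theorem restrict_toFun_eq_zero {P : PrimeSpectrum T} {m : PrimeSpectrum A}
    (h : ¬ comap (algebraMap A T) P ≤ m) :
    ((localLength m).restrict T).toFun (T ⧸ P.asIdeal) = 0 := by
  rw [LengthFunction.restrict_apply, localLength_eq_zero_iff]
  exact fun hm => h (support_quotient_subset P hm)

variable [IsNoetherianRing A] [Module.Finite A T]

theorem restrict_toFun_ne_top {P : PrimeSpectrum T} {m : PrimeSpectrum A}
    (h : ¬ comap (algebraMap A T) P < m) :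
    ((localLength m).restrict T).toFun (T ⧸ P.asIdeal) ≠ ⊤ := by
  rw [LengthFunction.restrict_apply]
  refine localLength_ne_top_of_minimal (C := {n | comap (algebraMap A T) P ≤ n})
    (fun n hn hnm => ?_) _ (support_quotient_subset P)
  by_contra hne
  exact h (lt_of_le_of_lt hn (lt_of_le_of_ne hnm hne))

variable (δ : DimensionFunction A)

theorem dim_comap_lt {P Q : PrimeSpectrum T} (h : P < Q) :
    δ.dim (comap (algebraMap A T) Q) < δ.dim (comap (algebraMap A T) P) := by
  have := Algebra.IsIntegral.of_finite A T
  exact δ.dim_lt_of_lt _ _ (Ideal.IsIntegral.comap_lt_comap (R := A) (A := T) h)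

theorem restrict_toFun_ne_top_of_dim {P : PrimeSpectrum T} {m : PrimeSpectrum A}
    (h : δ.dim (comap (algebraMap A T) P) ≤ δ.dim m) :
    ((localLength m).restrict T).toFun (T ⧸ P.asIdeal) ≠ ⊤ :=
  restrict_toFun_ne_top fun hlt => absurd (δ.dim_lt_of_lt _ _ hlt) (not_lt.2 h)

theorem restrict_toFun_ne_top_of_lt {P : PrimeSpectrum T} {m : PrimeSpectrum A}
    (hm : δ.dim (comap (algebraMap A T) P) = δ.dim m + 1) {P' : PrimeSpectrum T} (h : P < P') :
    ((localLength m).restrict T).toFun (T ⧸ P'.asIdeal) ≠ ⊤ := by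
  refine restrict_toFun_ne_top_of_dim δ ?_
  have := dim_comap_lt δ h
  omega

theorem restrict_toFun_sup_ne_top {P : PrimeSpectrum T} {m : PrimeSpectrum A}
    (hm : δ.dim (comap (algebraMap A T) P) = δ.dim m + 1) {s : T} (hs : s ∉ P.asIdeal) :
    ((localLength m).restrict T).toFun (T ⧸ (P.asIdeal ⊔ Ideal.span {s})) ≠ ⊤ := by
  have := IsNoetherianRing.of_finite A T
  refine LengthFunction.ne_top_of_support _
    (C := Module.support T (T ⧸ (P.asIdeal ⊔ Ideal.span {s}))) (fun P' hP' => ?_) _ subset_rfl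
  rw [mem_support_quotient] at hP'
  refine restrict_toFun_ne_top_of_lt δ hm (lt_of_le_of_ne (le_sup_left.trans hP') ?_)
  rintro rfl
  exact hs (hP' (Ideal.mem_sup_right (Ideal.mem_span_singleton_self s)))

theorem herbrand_eq_mul {P : PrimeSpectrum T} {m : PrimeSpectrum A}
    (hm : δ.dim (comap (algebraMap A T) P) = δ.dim m + 1) {s : T} (hs : s ∉ P.asIdeal)
    (M : Type u) [AddCommGroup M] [Module T M] [Module.Finite T M]
    (hM : Module.support T M ⊆ {P' | P ≤ P'}) :
    ((localLength m).restrict T).herbrand s M =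
      (((localLength P).toFun M).toNat : ℤ) * quotientLength ((localLength m).restrict T) P s := by
  have := IsNoetherianRing.of_finite A T
  have hC : ∀ P' ∈ {P' | P ≤ P'}, ((localLength m).restrict T).HerbrandFinite s (T ⧸ P'.asIdeal) := by
    intro P' hP'
    rcases (show P ≤ P' from hP').eq_or_lt with rfl | hlt
    · exact herbrandFinite_of_notMem _ hs (restrict_toFun_sup_ne_top δ hm hs)
    · exact LengthFunction.herbrandFinite_of_ne_top _ _ (restrict_toFun_ne_top_of_lt δ hm hlt)
  have h := (LengthFunction.herbrandAdditiveOn _ s hC).eq_sum {P} ?_ ?_ M hM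
  · rw [Finset.sum_singleton] at h
    rw [← herbrand_eq_quotientLength _ hs]
    exact h
  · intro P' hP' P'' hP'' hle
    rw [Finset.mem_singleton] at hP'
    subst hP'
    exact le_antisymm hle hP''
  · intro P' hP' hne
    rw [Finset.mem_singleton] at hne
    exact LengthFunction.herbrand_eq_zero _ _ 
      (restrict_toFun_ne_top_of_lt δ hm (lt_of_le_of_ne hP' (Ne.symm hne)))

end Finite

section MinimalPolynomial

open Polynomial

/-- A suitable multiple `c • s` of an element of an integral extension has a minimal polynomial
with coefficients in the base; its constant coefficient generates the multiples of `c • s` in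
the ring generated by `c • s` that lie in the base. -/
theorem exists_constantCoeff {C V : Type*} [CommRing C] [IsDomain C] [CommRing V] [IsDomain V]
    [Algebra C V] [FaithfulSMul C V] [Algebra.IsIntegral C V] {s : V} (hs : s ≠ 0) :
    ∃ c y : C, c ≠ 0 ∧ y ≠ 0 ∧
      (∃ h : C[X], algebraMap C V y = (algebraMap C V c * s) * aeval (algebraMap C V c * s) h) ∧
      ∀ (a : C) (h : C[X]), algebraMap C V a =
        (algebraMap C V c * s) * aeval (algebraMap C V c * s) h → y ∣ a := by
  classical
  have hinj : ∀ x : C, algebraMap C V x = 0 → x = 0 := fun x hx =>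
    FaithfulSMul.algebraMap_injective C V (hx.trans (map_zero _).symm)
  let p : ℕ → Prop := fun e => ∃ (c : C) (F : C[X]), c ≠ 0 ∧ F.Monic ∧ F.natDegree = e ∧
    aeval (algebraMap C V c * s) F = 0
  have hp : ∃ e, p e := by
    obtain ⟨F, hF, hFs⟩ := Algebra.IsIntegral.isIntegral (R := C) s
    exact ⟨_, 1, F, one_ne_zero, hF, rfl, by simpa using! hFs⟩
  obtain ⟨c, F, hc, hF, hdeg, hroot⟩ := Nat.find_spec hp
  have hmin : ∀ h : C[X], aeval (algebraMap C V c * s) h = 0 → h ≠ 0 →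
      F.natDegree ≤ h.natDegree := by
    intro h hh h0
    rw [hdeg]
    refine Nat.find_min' hp ⟨h.leadingCoeff * c, h.integralNormalization,
      mul_ne_zero (leadingCoeff_ne_zero.2 h0) hc, monic_integralNormalization h0,
      natDegree_integralNormalization, ?_⟩
    rw [map_mul, mul_assoc]
    exact integralNormalization_aeval_eq_zero hh hinj
  have hg : algebraMap C V c * s ≠ 0 := mul_ne_zero (fun h => hc (hinj c h)) hs
  refine ⟨c, F.coeff 0, hc, ?_⟩
  generalize algebraMap C V c * s = g at *
  have hF1 : F.natDegree ≠ 0 := by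
    intro h
    rw [hF.natDegree_eq_zero.1 h] at hroot
    simp at hroot
  have hy : algebraMap C V (F.coeff 0) = -(g * aeval g F.divX) := by
    have := hroot
    rw [← X_mul_divX_add F, map_add, map_mul, aeval_X, aeval_C] at this
    exact eq_neg_of_add_eq_zero_right this
  refine ⟨fun h0 => ?_, ⟨-F.divX, by rw [hy, map_neg, mul_neg]⟩,
    fun a h hah => ?_⟩
  · rw [h0, map_zero] at hy
    have h1 : aeval g F.divX = 0 := (mul_eq_zero.1 (neg_eq_zero.1 hy.symm)).resolve_left hg
    have h2 : F.divX ≠ 0 := by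
      intro h2
      have := X_mul_divX_add F
      rw [h2, h0] at this
      exact hF.ne_zero (by rw [← this]; simp)
    have h3 := hmin _ h1 h2
    rw [natDegree_divX_eq_natDegree_tsub_one] at h3
    omega
  · have h1 : aeval g (Polynomial.C a - X * h) = 0 := by
      rw [map_sub, map_mul, aeval_C, aeval_X, hah, sub_self]
    have h2 : aeval g ((Polynomial.C a - X * h) %ₘ F) = 0 := by
      rw [modByMonic_eq_sub_mul_div, map_sub, map_mul, hroot, h1, zero_mul, sub_zero]
    have h3 : (Polynomial.C a - X * h) %ₘ F = 0 := by
      by_contra h3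
      have h4 := hmin _ h2 h3
      have h5 := natDegree_modByMonic_lt (Polynomial.C a - X * h) hF (fun h => hF1 (by simp [h]))
      omega
    obtain ⟨k, hk⟩ := (modByMonic_eq_zero_iff_dvd hF).1 h3
    have h6 := congrArg (fun p => Polynomial.coeff p 0) hk
    simp only [coeff_sub, coeff_C_zero, mul_coeff_zero, coeff_X_zero, zero_mul, sub_zero] at h6
    exact ⟨_, h6⟩

end MinimalPolynomial

section Pushforward

variable {A : Type u} [CommRing A] [IsNoetherianRing A] (δ : DimensionFunction A)
  {S : Type u} [CommRing S] [Algebra A S] [Module.Finite A S]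

theorem quotientLength_algebraMap {Q : PrimeSpectrum S} {m : PrimeSpectrum A}
    (hm : δ.dim (comap (algebraMap A S) Q) = δ.dim m + 1) {a : A}
    (ha : a ∉ (comap (algebraMap A S) Q).asIdeal) :
    quotientLength ((localLength m).restrict S) Q (algebraMap A S a) =
      (((localLength (comap (algebraMap A S) Q)).toFun (S ⧸ Q.asIdeal)).toNat : ℤ) *
        quotientLength (localLength m) (comap (algebraMap A S) Q) a := by
  have h1 : comap (algebraMap A A) (comap (algebraMap A S) Q) = comap (algebraMap A S) Q := rfl
  have e := herbrand_eq_mul δ (T := A) (P := comap (algebraMap A S) Q) (m := m) (h1 ▸ hm) ha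
    (S ⧸ Q.asIdeal) (support_quotient_subset Q)
  rw [quotientLength_restrict_self] at e
  rw [← e, ← herbrand_eq_quotientLength _ (show algebraMap A S a ∉ Q.asIdeal from ha)]
  exact herbrand_restrict_congr _ S A _ fun x => algebraMap_smul S a x

/-- The pushforward to `A` of a principal divisor on a finite `A`-algebra is a linear combination
of principal divisors. -/
theorem exists_quotientLength_eq (Q : PrimeSpectrum S) {s : S} (hs : s ∉ Q.asIdeal) :
    ∃ (c y : A) (k n : ℤ), c ∉ (comap (algebraMap A S) Q).asIdeal ∧
      y ∉ (comap (algebraMap A S) Q).asIdeal ∧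
      ∀ m : PrimeSpectrum A, δ.dim (comap (algebraMap A S) Q) = δ.dim m + 1 →
        quotientLength ((localLength m).restrict S) Q s =
          k * quotientLength (localLength m) (comap (algebraMap A S) Q) y -
            n * quotientLength (localLength m) (comap (algebraMap A S) Q) c := by
  let q := comap (algebraMap A S) Q
  let _ : Algebra (A ⧸ q.asIdeal) (S ⧸ Q.asIdeal) :=
    (Ideal.quotientMap Q.asIdeal (algebraMap A S) le_rfl).toAlgebra
  have : IsScalarTower A (A ⧸ q.asIdeal) (S ⧸ Q.asIdeal) := .of_algebraMap_eq fun _ => rfl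
  have : FaithfulSMul (A ⧸ q.asIdeal) (S ⧸ Q.asIdeal) :=
    (faithfulSMul_iff_algebraMap_injective _ _).2 Ideal.quotientMap_injective
  have : Algebra.IsIntegral (A ⧸ q.asIdeal) (S ⧸ Q.asIdeal) := Algebra.IsIntegral.tower_top A
  obtain ⟨c, y, hc, hy, ⟨h0, hh0⟩, hdvd⟩ := exists_constantCoeff (C := A ⧸ q.asIdeal)
    (V := S ⧸ Q.asIdeal) (s := Ideal.Quotient.mk _ s)
    (fun h => hs (Ideal.Quotient.eq_zero_iff_mem.1 h))
  obtain ⟨c, rfl⟩ := Ideal.Quotient.mk_surjective c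
  obtain ⟨y, rfl⟩ := Ideal.Quotient.mk_surjective y
  have hc : c ∉ q.asIdeal := fun h => hc (Ideal.Quotient.eq_zero_iff_mem.2 h)
  have hy : y ∉ q.asIdeal := fun h => hy (Ideal.Quotient.eq_zero_iff_mem.2 h)
  have hcS : algebraMap A S c ∉ Q.asIdeal := hc
  have hg : algebraMap (A ⧸ q.asIdeal) (S ⧸ Q.asIdeal) (Ideal.Quotient.mk _ c) *
      Ideal.Quotient.mk _ s = Ideal.Quotient.mk _ (algebraMap A S c * s) := rfl
  rw [hg] at hh0 hdvd
  set g : S ⧸ Q.asIdeal := Ideal.Quotient.mk _ (algebraMap A S c * s) with hgdef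
  have hcs : algebraMap A S c * s ∉ Q.asIdeal := fun h => (Q.isPrime.mem_or_mem h).elim hcS hs
  have hg0 : g ≠ 0 := fun h => hcs (Ideal.Quotient.eq_zero_iff_mem.1 h)
  let T : Subalgebra A (S ⧸ Q.asIdeal) := Algebra.adjoin A {g}
  have hTf : Module.Finite A T := inferInstanceAs (Module.Finite A (Subalgebra.toSubmodule T))
  have : Module.Finite T (S ⧸ Q.asIdeal) := Module.Finite.of_restrictScalars_finite A T _
  let γ : T := ⟨g, Algebra.subset_adjoin rfl⟩
  have hγ : γ ∉ (⊥ : PrimeSpectrum T).asIdeal := fun h => hg0 (congrArg Subtype.val h)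
  have hbot : comap (algebraMap A T) (⊥ : PrimeSpectrum T) = q := by
    ext a
    change algebraMap A T a = 0 ↔ algebraMap A S a ∈ Q.asIdeal
    rw [← Ideal.Quotient.eq_zero_iff_mem, Subtype.ext_iff]
    rfl
  have hmap : ∀ h : Polynomial A, Polynomial.aeval g (h.map (Ideal.Quotient.mk q.asIdeal)) =
      Polynomial.aeval g h := fun h => Polynomial.aeval_map_algebraMap (A ⧸ q.asIdeal) g h
  have hT : ∀ t : T, ∃ h : Polynomial A, (t : S ⧸ Q.asIdeal) = Polynomial.aeval g h := by
    intro t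
    obtain ⟨h, hh⟩ := (Algebra.adjoin_singleton_eq_range_aeval A g).le t.2
    exact ⟨h, hh.symm⟩
  have hTm : ∀ h : Polynomial A, Polynomial.aeval g h ∈ T := fun h =>
    (Algebra.adjoin_singleton_eq_range_aeval A g).ge ⟨h, rfl⟩
  have hlen : ∀ m : PrimeSpectrum A, quotientLength ((localLength m).restrict T) ⊥ γ =
      quotientLength (localLength m) q y := by
    intro m
    rw [quotientLength, quotientLength, LengthFunction.restrict_apply]
    let f : A →ₗ[A] T ⧸ ((⊥ : PrimeSpectrum T).asIdeal ⊔ Ideal.span {γ}) :=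
      Algebra.linearMap A _
    have hmem : ∀ t : T, t ∈ (⊥ : PrimeSpectrum T).asIdeal ⊔ Ideal.span {γ} ↔ γ ∣ t := by
      intro t
      rw [← Ideal.mem_span_singleton]
      change t ∈ (⊥ : Ideal T) ⊔ _ ↔ _
      rw [bot_sup_eq]
    have hfs : Function.Surjective f := by
      intro x
      obtain ⟨t, rfl⟩ := Ideal.Quotient.mk_surjective x
      obtain ⟨h, hh⟩ := hT t
      refine ⟨h.coeff 0, ?_⟩
      change Ideal.Quotient.mk _ (algebraMap A T (h.coeff 0)) = _
      rw [Ideal.Quotient.eq, hmem]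
      refine ⟨⟨_, hTm (-h.divX)⟩, Subtype.ext ?_⟩
      change algebraMap A _ (h.coeff 0) - (t : S ⧸ Q.asIdeal) = g * Polynomial.aeval g (-h.divX)
      rw [hh]
      have e := congrArg (Polynomial.aeval g) (Polynomial.X_mul_divX_add h)
      rw [map_add, map_mul, Polynomial.aeval_X, Polynomial.aeval_C] at e
      rw [map_neg, ← e]
      ring
    refine congrArg (fun n : ℕ∞ => (n.toNat : ℤ)) (toFun_eq_of_surjective _ f hfs ?_)
    ext a
    have h1 : a ∈ LinearMap.ker f ↔ γ ∣ algebraMap A T a := by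
      rw [← hmem]
      exact Ideal.Quotient.eq_zero_iff_mem
    have h2 : a ∈ q.asIdeal ⊔ Ideal.span {y} ↔
        Ideal.Quotient.mk q.asIdeal y ∣ Ideal.Quotient.mk q.asIdeal a := by
      rw [← Ideal.mem_span_singleton, ← Set.image_singleton, ← Ideal.map_span,
        ← Ideal.mem_comap, Ideal.comap_map_of_surjective' _ Ideal.Quotient.mk_surjective,
        Ideal.mk_ker, sup_comm]
    rw [h1, h2]
    constructor
    · rintro ⟨t, ht⟩
      obtain ⟨h, hh⟩ := hT t
      refine hdvd _ (h.map (Ideal.Quotient.mk q.asIdeal)) ?_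
      rw [hmap, ← hh]
      exact congrArg Subtype.val ht
    · rintro ⟨b, hb⟩
      obtain ⟨b, rfl⟩ := Ideal.Quotient.mk_surjective b
      obtain ⟨h, rfl⟩ := Polynomial.map_surjective _ Ideal.Quotient.mk_surjective h0
      rw [hmap] at hh0
      refine ⟨⟨_, hTm (h * Polynomial.C b)⟩, Subtype.ext ?_⟩
      have h3 := congrArg (algebraMap (A ⧸ q.asIdeal) (S ⧸ Q.asIdeal)) hb
      rw [map_mul, hh0] at h3
      change algebraMap A (S ⧸ Q.asIdeal) a = g * Polynomial.aeval g (h * Polynomial.C b)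
      rw [map_mul, Polynomial.aeval_C, ← mul_assoc]
      exact h3
  refine ⟨c, y, ((localLength (⊥ : PrimeSpectrum T)).toFun (S ⧸ Q.asIdeal)).toNat,
    ((localLength q).toFun (S ⧸ Q.asIdeal)).toNat, hc, hy, fun m hm => ?_⟩
  have e1 := herbrand_eq_mul δ (T := T) (P := ⊥) (m := m) (by rw [hbot]; exact hm) hγ
    (S ⧸ Q.asIdeal) fun P' _ => (bot_le : (⊥ : PrimeSpectrum T) ≤ P')
  rw [hlen, ← herbrand_restrict_congr (localLength m) S T (S ⧸ Q.asIdeal)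
      (s := algebraMap A S c * s) (t := γ) ?_,
    herbrand_eq_quotientLength _ hcs] at e1
  · have e2 : quotientLength ((localLength m).restrict S) Q (algebraMap A S c * s) =
        quotientLength ((localLength m).restrict S) Q (algebraMap A S c) +
          quotientLength ((localLength m).restrict S) Q s := by
      rw [quotientLength, toFun_quotient_mul _ hs,
        ENat.toNat_add (restrict_toFun_sup_ne_top δ hm hcS) (restrict_toFun_sup_ne_top δ hm hs),
        Nat.cast_add]
      rfl
    have e3 := quotientLength_algebraMap δ hm hc
    rw [← e1, ← e3, e2]
    ring
  · intro x
    obtain ⟨x, rfl⟩ := Ideal.Quotient.mk_surjective x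
    rfl

end Pushforward

section Quotient

theorem multiplicity_eq_quotientLength {A : Type u} [CommRing A] (p q : PrimeSpectrum A) (x : A) :
    (multiplicity p x q : ℤ) = quotientLength (localLength q) p x := by
  rw [multiplicity_eq]
  rfl

variable {A : Type u} [CommRing A] [IsNoetherianRing A] (δ : DimensionFunction A)

theorem multiplicity_quotient (u : A) {q m : PrimeSpectrum (A ⧸ Ideal.span {u})}
    (hm : (δ.quotient u).dim q = (δ.quotient u).dim m + 1) {y : A}
    (hy : Ideal.Quotient.mk (Ideal.span {u}) y ∉ q.asIdeal) :
    multiplicity q (Ideal.Quotient.mk (Ideal.span {u}) y) m =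
      multiplicity (comap (Ideal.Quotient.mk (Ideal.span {u})) q) y
        (comap (Ideal.Quotient.mk (Ideal.span {u})) m) := by
  have hs : Function.Surjective (Ideal.Quotient.mk (Ideal.span {u})) := Ideal.Quotient.mk_surjective
  let B := A ⧸ Ideal.span {u}
  let I : Ideal B := q.asIdeal ⊔ Ideal.span {Ideal.Quotient.mk (Ideal.span {u}) y}
  let m' := comap (Ideal.Quotient.mk (Ideal.span {u})) m
  let l := (localLength m').restrict B
  have hlt : ∀ P P' : PrimeSpectrum B, P < P' →
      (δ.quotient u).dim P' < (δ.quotient u).dim P := fun P P' h => dim_comap_lt (T := B) δ h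
  have hC : ∀ P ∈ Module.support B (B ⧸ I), (δ.quotient u).dim P ≤ (δ.quotient u).dim m := by
    intro P hP
    rw [mem_support_quotient] at hP
    have hqP : q < P := by
      refine lt_of_le_of_ne (le_sup_left.trans hP) ?_
      rintro rfl
      exact hy (hP (Ideal.mem_sup_right (Ideal.mem_span_singleton_self _)))
    have := hlt _ _ hqP
    omega
  have h := (l.toAdditiveOn (C := Module.support B (B ⧸ I)) fun P hP =>
    restrict_toFun_ne_top_of_dim (T := B) δ (hC P hP)).eq_sum {m} ?_ ?_ (B ⧸ I) subset_rfl
  · have h1 : l.toFun (B ⧸ m.asIdeal) = 1 := by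
      rw [LengthFunction.restrict_apply, toFun_eq_of_surjective (localLength m')
        (Algebra.linearMap A (B ⧸ m.asIdeal)) (Ideal.Quotient.mk_surjective.comp hs)
        (I := m'.asIdeal), localLength_quotient_self]
      ext a
      exact Ideal.Quotient.eq_zero_iff_mem
    have h2 : l.toFun (B ⧸ I) = (localLength m').toFun
        (A ⧸ ((comap (Ideal.Quotient.mk (Ideal.span {u})) q).asIdeal ⊔ Ideal.span {y})) := by
      rw [LengthFunction.restrict_apply]
      refine toFun_eq_of_surjective (localLength m')
        (Algebra.linearMap A (B ⧸ I)) (Ideal.Quotient.mk_surjective.comp hs) ?_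
      have hI : I = Ideal.map (Ideal.Quotient.mk (Ideal.span {u}))
          ((comap (Ideal.Quotient.mk (Ideal.span {u})) q).asIdeal ⊔ Ideal.span {y}) := by
        rw [Ideal.map_sup, Ideal.map_span, Set.image_singleton, comap_asIdeal,
          Ideal.map_comap_of_surjective _ hs]
      have hu : Ideal.span {u} ≤ (comap (Ideal.Quotient.mk (Ideal.span {u})) q).asIdeal := by
        rw [Ideal.span_singleton_le_iff_mem, comap_asIdeal, Ideal.mem_comap,
          Ideal.Quotient.eq_zero_iff_mem.2 (Ideal.mem_span_singleton_self u)]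
        exact zero_mem _
      have hcm : Ideal.comap (Ideal.Quotient.mk (Ideal.span {u})) I =
          (comap (Ideal.Quotient.mk (Ideal.span {u})) q).asIdeal ⊔ Ideal.span {y} := by
        rw [hI, Ideal.comap_map_of_surjective' _ hs, Ideal.mk_ker]
        exact sup_eq_left.2 (hu.trans le_sup_left)
      rw [← hcm]
      ext a
      exact Ideal.Quotient.eq_zero_iff_mem
    rw [multiplicity_eq, multiplicity_eq]
    simp only [Finset.sum_singleton, LengthFunction.toAdditiveOn, h1, h2] at h
    simpa using h.symm
  · intro P hP P' hP' hle
    rw [Finset.mem_singleton] at hP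
    subst hP
    by_contra hne
    exact absurd (hlt _ _ (lt_of_le_of_ne hle hne)) (not_lt.2 (hC P' hP'))
  · intro P hP hne
    rw [Finset.mem_singleton] at hne
    have h0 : l.toFun (B ⧸ P.asIdeal) = 0 := by
      refine restrict_toFun_eq_zero fun hle => ?_
      have hle' : P ≤ m :=
        (Ideal.comap_le_comap_iff_of_surjective (Ideal.Quotient.mk (Ideal.span {u})) hs P.asIdeal
          m.asIdeal).1 hle
      exact absurd (hlt _ _ (lt_of_le_of_ne hle' hne)) (not_lt.2 (hC P hP))
    simp [LengthFunction.toAdditiveOn, h0]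

theorem divisor_apply {i : ℤ} (p : PrimeSpectrum A) (hp : δ.dim p = i + 1) (x : A)
    (hx : x ∉ p.asIdeal) (q : {q : PrimeSpectrum A // δ.dim q = i}) :
    divisor δ p hp x hx q = multiplicity p x q.1 := rfl

end Quotient

section Normalization

theorem localLength_normalization {A : Type u} [CommRing A] {S : Type u} [CommRing S] [IsDomain S]
    [Algebra A S]
    (hbir : ∀ s : S, ∃ c a : A, algebraMap A S c ≠ 0 ∧ algebraMap A S c * s = algebraMap A S a) :
    (localLength (comap (algebraMap A S) ⊥)).toFun (S ⧸ (⊥ : PrimeSpectrum S).asIdeal) = 1 := by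
  let f : A →ₗ[A] S ⧸ (⊥ : PrimeSpectrum S).asIdeal := Algebra.linearMap A _
  have hf : LinearMap.ker f = (comap (algebraMap A S) ⊥).asIdeal := by
    ext a
    exact Ideal.Quotient.eq_zero_iff_mem
  rw [(localLength _).eq_submodule_add_quotient (LinearMap.range f),
    ← (localLength _).congr f.quotKerEquivRange, hf, localLength_quotient_self,
    (localLength_eq_zero_iff _ _).2, add_zero]
  rw [Module.notMem_support_iff']
  intro x
  obtain ⟨x, rfl⟩ := Submodule.mkQ_surjective _ x
  obtain ⟨s, rfl⟩ := Ideal.Quotient.mk_surjective x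
  obtain ⟨c, a, hc, hca⟩ := hbir s
  refine ⟨c, hc, ?_⟩
  refine (Submodule.Quotient.mk_eq_zero _).2 ⟨a, ?_⟩
  change Ideal.Quotient.mk _ (algebraMap A S a) = c • Ideal.Quotient.mk _ s
  rw [← hca, map_mul, Algebra.smul_def]
  rfl

variable {A : Type u} [CommRing A] [IsNoetherianRing A] (δ : DimensionFunction A)
  {S : Type u} [CommRing S] [Algebra A S]

theorem restrict_toFun_eq_zero_of_ne {q : PrimeSpectrum A} {Q : PrimeSpectrum S}
    (hQ : δ.dim (comap (algebraMap A S) Q) ≤ δ.dim q) (hne : comap (algebraMap A S) Q ≠ q) :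
    ((localLength q).restrict S).toFun (S ⧸ Q.asIdeal) = 0 := by
  refine restrict_toFun_eq_zero fun hle => ?_
  have := δ.dim_lt_of_lt _ _ (lt_of_le_of_ne hle hne)
  omega

variable [Module.Finite A S]

theorem quotientLength_eq_zero_of_dim {Q : PrimeSpectrum S} {m : PrimeSpectrum A}
    (h : δ.dim (comap (algebraMap A S) Q) ≤ δ.dim m) {s : S} (hs : s ∉ Q.asIdeal) :
    quotientLength ((localLength m).restrict S) Q s = 0 := by
  rw [← herbrand_eq_quotientLength _ hs]
  exact LengthFunction.herbrand_eq_zero _ _ (restrict_toFun_ne_top_of_dim δ h)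

variable [IsDomain S]

theorem dim_comap_add_two_le {P : PrimeSpectrum S} (hP : P ≠ ⊥) (hPa : ¬ IsAtom P) :
    δ.dim (comap (algebraMap A S) P) + 2 ≤ δ.dim (comap (algebraMap A S) ⊥) := by
  simp only [IsAtom, not_and, not_forall] at hPa
  obtain ⟨Q, hQP, hQ⟩ := hPa hP
  have h1 := dim_comap_lt δ hQP
  have h2 := dim_comap_lt δ (bot_lt_iff_ne_bot.2 hQ)
  omega

theorem dim_comap_add_one_le {P : PrimeSpectrum S} (hP : P ≠ ⊥) :
    δ.dim (comap (algebraMap A S) P) + 1 ≤ δ.dim (comap (algebraMap A S) ⊥) := by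
  have h2 := dim_comap_lt δ (bot_lt_iff_ne_bot.2 hP)
  omega

theorem restrict_toFun_ne_top_of_not_isAtom {m : PrimeSpectrum A}
    (hm : δ.dim (comap (algebraMap A S) ⊥) = δ.dim m + 2) (P : PrimeSpectrum S) (hP : P ≠ ⊥)
    (hPa : ¬ IsAtom P) : ((localLength m).restrict S).toFun (S ⧸ P.asIdeal) ≠ ⊤ := by
  refine restrict_toFun_ne_top_of_dim δ ?_
  have := dim_comap_add_two_le δ hP hPa
  omega

theorem multiplicity_eq_sum [IsNoetherianRing S]
    (hbir : ∀ s : S, ∃ c a : A, algebraMap A S c ≠ 0 ∧ algebraMap A S c * s = algebraMap A S a)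
    {x : A} (hx : algebraMap A S x ≠ 0) {q : PrimeSpectrum A}
    (hq : δ.dim (comap (algebraMap A S) ⊥) = δ.dim q + 1) :
    (multiplicity (comap (algebraMap A S) ⊥) x q : ℤ) =
      ∑ Q ∈ heightOneSupport (algebraMap A S x), (vanishingOrder Q (algebraMap A S x) : ℤ) *
        (((localLength q).restrict S).toFun (S ⧸ Q.asIdeal)).toNat := by
  have h := quotientLength_algebraMap δ (Q := (⊥ : PrimeSpectrum S)) hq (a := x) hx
  rw [localLength_normalization hbir, ENat.toNat_one, Nat.cast_one, one_mul] at h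
  rw [multiplicity_eq_quotientLength, ← h, quotientLength,
    show (⊥ : PrimeSpectrum S).asIdeal = ⊥ from rfl, bot_sup_eq]
  have hne : ∀ P ∈ {P : PrimeSpectrum S | algebraMap A S x ∈ P.asIdeal}, P ≠ ⊥ := by
    rintro P hP rfl
    exact hx hP
  refine (((localLength q).restrict S).toAdditiveOn
    (C := {P : PrimeSpectrum S | algebraMap A S x ∈ P.asIdeal}) fun P hP =>
      restrict_toFun_ne_top_of_dim δ ?_).eq_sum (heightOneSupport (algebraMap A S x)) ?_ ?_
      (S ⧸ Ideal.span {algebraMap A S x}) ?_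
  · have := dim_comap_add_one_le δ (hne P hP)
    omega
  · intro P hP Q hQ hle
    rw [mem_heightOneSupport hx] at hP
    exact isAtom_le hP.1 hle hx hQ
  · intro P hP hPF
    rw [mem_heightOneSupport hx] at hPF
    have h2 := dim_comap_add_two_le δ (hne P hP) fun h => hPF ⟨h, hP⟩
    have h0 : ((localLength q).restrict S).toFun (S ⧸ P.asIdeal) = 0 := by
      refine restrict_toFun_eq_zero_of_ne δ (by omega) ?_
      rintro rfl
      omega
    simp [LengthFunction.toAdditiveOn, h0]
  · intro P hP
    rw [mem_support_quotient] at hP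
    exact hP (Ideal.mem_span_singleton_self _)

variable {i : ℤ} (hdim : δ.dim (comap (algebraMap A S) ⊥) = i + 1) (u : A)

include hdim

/-- The pushforward to `A / u` of a principal divisor on `S / Q`, where `Q` contains `u`. -/
theorem exists_rationallyTrivial_quotientLength {Q : PrimeSpectrum S} (hQ : Q ≠ ⊥)
    (hu : algebraMap A S u ∈ Q.asIdeal) {s : S} (hs : s ∉ Q.asIdeal) :
    ∃ z ∈ rationallyTrivial (δ.quotient u) (i - 1), ∀ m, z m =
      quotientLength ((localLength (liftPrime δ u (i - 1) m).1).restrict S) Q s := by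
  have hle := dim_comap_add_one_le δ hQ
  by_cases hi : δ.dim (comap (algebraMap A S) Q) = i
  · obtain ⟨c, y, k, n, hc, hy, h⟩ := exists_quotientLength_eq δ Q hs
    have hr : comap (algebraMap A S) Q ∈
        Set.range (PrimeSpectrum.comap (Ideal.Quotient.mk (Ideal.span {u}))) := by
      rw [range_comap_of_surjective _ _ Ideal.Quotient.mk_surjective, Ideal.mk_ker]
      exact (Ideal.span_singleton_le_iff_mem _).2 hu
    obtain ⟨q, hq⟩ := hr
    rw [← hq] at hc hy h hi
    have hc : Ideal.Quotient.mk (Ideal.span {u}) c ∉ q.asIdeal := hc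
    have hy : Ideal.Quotient.mk (Ideal.span {u}) y ∉ q.asIdeal := hy
    have hqd : (δ.quotient u).dim q = i - 1 + 1 := hi.trans (by ring)
    refine ⟨k • divisor (δ.quotient u) q hqd (Ideal.Quotient.mk _ y) hy -
      n • divisor (δ.quotient u) q hqd (Ideal.Quotient.mk _ c) hc, ?_, fun m => ?_⟩
    · refine AddSubgroup.sub_mem _ (AddSubgroup.zsmul_mem _ (AddSubgroup.subset_closure ?_) _)
        (AddSubgroup.zsmul_mem _ (AddSubgroup.subset_closure ?_) _)
      · exact ⟨q, hqd, _, hy, rfl⟩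
      · exact ⟨q, hqd, _, hc, rfl⟩
    · have hm : (δ.quotient u).dim q = (δ.quotient u).dim m.1 + 1 := by rw [hqd, m.2]
      refine Eq.trans ?_ (h _ hm).symm
      rw [Finsupp.sub_apply, Finsupp.smul_apply, Finsupp.smul_apply, divisor_apply,
        divisor_apply, multiplicity_quotient δ u hm hy, multiplicity_quotient δ u hm hc,
        multiplicity_eq_quotientLength, multiplicity_eq_quotientLength, smul_eq_mul, smul_eq_mul]
  · refine ⟨0, AddSubgroup.zero_mem _, fun m => ?_⟩
    rw [quotientLength_eq_zero_of_dim δ _ hs]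
    · rfl
    · rw [(liftPrime δ u (i - 1) m).2]
      omega

variable [IsIntegrallyClosed S]

theorem exists_rationallyTrivial_tameLength {Q : PrimeSpectrum S} (hQ : IsAtom Q)
    (hu : algebraMap A S u ∈ Q.asIdeal) {a b : S} (ha : a ≠ 0) (hb : b ≠ 0) :
    ∃ z ∈ rationallyTrivial (δ.quotient u) (i - 1), ∀ m, z m =
      tameLength ((localLength (liftPrime δ u (i - 1) m).1).restrict S) Q a b := by
  have := IsNoetherianRing.of_finite A S
  obtain ⟨r, s, hr, hs, h⟩ := exists_tame hQ ha hb
  obtain ⟨z, hz, hzs⟩ := exists_rationallyTrivial_quotientLength δ hdim u hQ.1 hu hs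
  obtain ⟨w, hw, hwr⟩ := exists_rationallyTrivial_quotientLength δ hdim u hQ.1 hu hr
  refine ⟨z - w, AddSubgroup.sub_mem _ hz hw, fun m => ?_⟩
  rw [tameLength_eq _ (restrict_toFun_ne_top_of_not_isAtom δ ?_) hQ ha hb hr hs h,
    Finsupp.sub_apply, hzs, hwr]
  rw [(liftPrime δ u (i - 1) m).2, hdim]
  ring

open scoped Classical in
theorem sum_eq_neg_sum_tameLength [IsNoetherianRing S] {x : A} (hx : algebraMap A S x ≠ 0)
    (hu : algebraMap A S u ≠ 0) {m : PrimeSpectrum A} (hm : δ.dim m = i - 1) :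
    ∑ Q ∈ heightOneSupport (algebraMap A S x), (vanishingOrder Q (algebraMap A S x) : ℤ) *
        (if algebraMap A S u ∈ Q.asIdeal then 0
          else quotientLength ((localLength m).restrict S) Q (algebraMap A S u)) =
      - ∑ Q ∈ heightOneSupport (algebraMap A S u), tameLength ((localLength m).restrict S) Q
        (algebraMap A S u) (algebraMap A S x) := by
  have hl := restrict_toFun_ne_top_of_not_isAtom (S := S) (m := m) δ (by rw [hm, hdim]; ring)
  have h := tameSum_eq_zero _ hl hu hx
  have h1 : tameSum ((localLength m).restrict S) (algebraMap A S u) (algebraMap A S x) =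
      ∑ Q ∈ (heightOneSupport (algebraMap A S x)).filter (fun Q => algebraMap A S u ∉ Q.asIdeal) ∪
        heightOneSupport (algebraMap A S u),
        tameLength ((localLength m).restrict S) Q (algebraMap A S u) (algebraMap A S x) := by
    refine finsum_eq_sum_of_support_subset _
      ((support_tameLength_subset _ hl hu hx).trans fun Q hQ => ?_)
    rw [Finset.mem_coe, mem_heightOneSupport (mul_ne_zero hu hx)] at hQ
    rw [Finset.mem_coe, Finset.mem_union, Finset.mem_filter, mem_heightOneSupport hx,
      mem_heightOneSupport hu]
    have := Q.isPrime.mem_or_mem hQ.2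
    tauto
  rw [h, Finset.sum_union, Finset.sum_filter] at h1
  · rw [eq_neg_iff_add_eq_zero]
    refine Eq.trans ?_ h1.symm
    congr 1
    refine Finset.sum_congr rfl fun Q hQ => ?_
    rw [mem_heightOneSupport hx] at hQ
    by_cases huQ : algebraMap A S u ∈ Q.asIdeal
    · simp [huQ]
    · rw [if_neg huQ, if_pos huQ, tameLength_of_notMem_left _ hl hQ.1 hu hx huQ]
  · rw [Finset.disjoint_left]
    intro Q hQ hQ'
    rw [mem_heightOneSupport hu] at hQ'
    exact (Finset.mem_filter.1 hQ).2 hQ'.2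

end Normalization

section Intersection

variable {A : Type u} [CommRing A] [IsNoetherianRing A] (δ : DimensionFunction A)

theorem intersectOfDim_apply (u : A) {i : ℤ} (z : CyclesOfDim δ i)
    (m : {q : PrimeSpectrum (A ⧸ Ideal.span {u}) // (δ.quotient u).dim q = i - 1})
    {F : Finset {q : PrimeSpectrum A // δ.dim q = i}} (hF : z.support ⊆ F) :
    intersectOfDim δ u i z m = ∑ q ∈ F, z q * intersectPrime δ u i q m := by
  have h : intersectOfDim δ u i z = ∑ q ∈ F, z q • intersectPrime δ u i q :=
    Finsupp.sum_of_support_subset z hF (fun q n => n • intersectPrime δ u i q)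
      fun _ _ => zero_smul _ _
  rw [h, Finsupp.finsetSum_apply]
  rfl

open scoped Classical in
theorem intersectPrime_apply (u : A) {i : ℤ} (q : {q : PrimeSpectrum A // δ.dim q = i})
    (m : {q : PrimeSpectrum (A ⧸ Ideal.span {u}) // (δ.quotient u).dim q = i - 1}) :
    intersectPrime δ u i q m = if u ∈ q.1.asIdeal then 0
      else quotientLength (localLength (liftPrime δ u (i - 1) m).1) q.1 u := by
  rw [intersectPrime]
  split_ifs with h
  · rfl
  · rw [← multiplicity_eq_quotientLength]
    rfl

theorem intersectOfDim_divisor_eq_zero (u : A) {i : ℤ} {p : PrimeSpectrum A}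
    (hp : δ.dim p = i + 1) {x : A} (hx : x ∉ p.asIdeal) (hu : u ∈ p.asIdeal) :
    intersectOfDim δ u i (divisor δ p hp x hx) = 0 := by
  ext m
  rw [intersectOfDim_apply δ u _ m subset_rfl, Finset.sum_eq_zero]
  · rfl
  · intro q hq
    rw [Finsupp.mem_support_iff, divisor_apply, Nat.cast_ne_zero] at hq
    rw [intersectPrime_apply, if_pos (le_of_multiplicity_ne_zero hq (Ideal.mem_sup_left hu)),
      mul_zero]

variable (S : Type u) [CommRing S] [IsDomain S] [Algebra A S] [Module.Finite A S]

open scoped Classical in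
theorem intersectOfDim_divisor_apply [IsNoetherianRing S]
    (hbir : ∀ s : S, ∃ c a : A, algebraMap A S c ≠ 0 ∧ algebraMap A S c * s = algebraMap A S a)
    {i : ℤ} (hp : δ.dim (comap (algebraMap A S) ⊥) = i + 1) {x : A}
    (hx : algebraMap A S x ≠ 0) (u : A)
    (m : {q : PrimeSpectrum (A ⧸ Ideal.span {u}) // (δ.quotient u).dim q = i - 1}) :
    intersectOfDim δ u i (divisor δ _ hp x hx) m =
      ∑ Q ∈ heightOneSupport (algebraMap A S x), (vanishingOrder Q (algebraMap A S x) : ℤ) *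
        (if algebraMap A S u ∈ Q.asIdeal then 0 else quotientLength
          ((localLength (liftPrime δ u (i - 1) m).1).restrict S) Q (algebraMap A S u)) := by
  have hQ0 : ∀ Q ∈ heightOneSupport (algebraMap A S x),
      δ.dim (comap (algebraMap A S) Q) ≤ i := by
    intro Q hQ
    have := dim_comap_add_one_le δ ((mem_heightOneSupport hx).1 hQ).1.1
    omega
  have hne : ∀ Q ∈ heightOneSupport (algebraMap A S x),
      ∀ q : {q : PrimeSpectrum A // δ.dim q = i}, comap (algebraMap A S) Q ≠ q.1 →
        ((localLength q.1).restrict S).toFun (S ⧸ Q.asIdeal) = 0 := fun Q hQ q h =>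
    restrict_toFun_eq_zero_of_ne δ ((hQ0 Q hQ).trans q.2.ge) h
  have hdiv : ∀ q : {q : PrimeSpectrum A // δ.dim q = i}, divisor δ _ hp x hx q =
      ∑ Q ∈ heightOneSupport (algebraMap A S x), (vanishingOrder Q (algebraMap A S x) : ℤ) *
        (((localLength q.1).restrict S).toFun (S ⧸ Q.asIdeal)).toNat := fun q =>
    (divisor_apply δ _ hp x hx q).trans (multiplicity_eq_sum δ hbir hx (by rw [hp, q.2]))
  let F : Finset {q : PrimeSpectrum A // δ.dim q = i} :=
    ((heightOneSupport (algebraMap A S x)).image (comap (algebraMap A S))).subtype _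
  have hF : (divisor δ _ hp x hx).support ⊆ F := by
    intro q hq
    rw [Finsupp.mem_support_iff, hdiv] at hq
    obtain ⟨Q, hQ, hQq⟩ := Finset.exists_ne_zero_of_sum_ne_zero hq
    rw [Finset.mem_subtype, Finset.mem_image]
    refine ⟨Q, hQ, ?_⟩
    by_contra h
    rw [hne Q hQ q h] at hQq
    simp at hQq
  rw [intersectOfDim_apply δ u _ m hF]
  simp_rw [hdiv, Finset.sum_mul]
  rw [Finset.sum_comm]
  refine Finset.sum_congr rfl fun Q hQ => ?_
  simp_rw [mul_assoc]
  rw [← Finset.mul_sum]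
  congr 1
  have hm := (liftPrime δ u (i - 1) m).2
  by_cases hi : δ.dim (comap (algebraMap A S) Q) = i
  · have hmem : (⟨comap (algebraMap A S) Q, hi⟩ : {q : PrimeSpectrum A // δ.dim q = i}) ∈ F := by
      rw [Finset.mem_subtype, Finset.mem_image]
      exact ⟨Q, hQ, rfl⟩
    rw [Finset.sum_eq_single_of_mem _ hmem, intersectPrime_apply]
    · by_cases huQ : algebraMap A S u ∈ Q.asIdeal
      · rw [if_pos huQ, if_pos (show u ∈ (comap (algebraMap A S) Q).asIdeal from huQ), mul_zero]
      · rw [if_neg huQ, if_neg (show u ∉ (comap (algebraMap A S) Q).asIdeal from huQ),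
          quotientLength_algebraMap δ (by rw [hm, hi]; ring) huQ, LengthFunction.restrict_apply]
    · intro q _ hq
      rw [hne Q hQ q fun h => hq (Subtype.ext h.symm)]
      simp
  · rw [Finset.sum_eq_zero]
    · split_ifs with huQ
      · rfl
      · have := hQ0 Q hQ
        rw [quotientLength_eq_zero_of_dim δ (by omega) huQ]
    · intro q _
      rw [hne Q hQ q fun h => hi (h ▸ q.2)]
      simp

theorem intersectOfDim_divisor_mem_of_normalization [IsIntegrallyClosed S]
    (hbir : ∀ s : S, ∃ c a : A, algebraMap A S c ≠ 0 ∧ algebraMap A S c * s = algebraMap A S a)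
    {i : ℤ} (hp : δ.dim (comap (algebraMap A S) ⊥) = i + 1) {x : A}
    (hx : algebraMap A S x ≠ 0) {u : A} (hu : algebraMap A S u ≠ 0) :
    intersectOfDim δ u i (divisor δ _ hp x hx) ∈ rationallyTrivial (δ.quotient u) (i - 1) := by
  classical
  have := IsNoetherianRing.of_finite A S
  have hex : ∀ Q : PrimeSpectrum S, ∃ z ∈ rationallyTrivial (δ.quotient u) (i - 1),
      Q ∈ heightOneSupport (algebraMap A S u) → ∀ m, z m =
        tameLength ((localLength (liftPrime δ u (i - 1) m).1).restrict S) Q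
          (algebraMap A S u) (algebraMap A S x) := by
    intro Q
    by_cases hQ : Q ∈ heightOneSupport (algebraMap A S u)
    · rw [mem_heightOneSupport hu] at hQ
      obtain ⟨z, hz, hzm⟩ := exists_rationallyTrivial_tameLength δ hp u hQ.1 hQ.2 hu hx
      exact ⟨z, hz, fun _ => hzm⟩
    · exact ⟨0, AddSubgroup.zero_mem _, fun h => absurd h hQ⟩
  choose z hz hzm using hex
  have h : intersectOfDim δ u i (divisor δ _ hp x hx) =
      - ∑ Q ∈ heightOneSupport (algebraMap A S u), z Q := by
    ext m
    rw [intersectOfDim_divisor_apply δ S hbir hp hx u m,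
      sum_eq_neg_sum_tameLength δ hp u hx hu (liftPrime δ u (i - 1) m).2, Finsupp.neg_apply,
      Finsupp.finsetSum_apply]
    exact congrArg _ (Finset.sum_congr rfl fun Q hQ => (hzm Q hQ m).symm)
  rw [h]
  exact AddSubgroup.neg_mem _ (AddSubgroup.sum_mem _ fun Q _ => hz Q)

end Intersection

section Main

variable {A : Type u} [CommRing A] [IsNoetherianRing A] (δ : DimensionFunction A)

theorem intersectOfDim_divisor_mem {p : PrimeSpectrum A}
    (hnorm : Module.Finite (A ⧸ p.asIdeal)
      (integralClosure (A ⧸ p.asIdeal) (FractionRing (A ⧸ p.asIdeal))))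
    (u : A) {i : ℤ} (hp : δ.dim p = i + 1) {x : A} (hx : x ∉ p.asIdeal) :
    intersectOfDim δ u i (divisor δ p hp x hx) ∈ rationallyTrivial (δ.quotient u) (i - 1) := by
  by_cases hu : u ∈ p.asIdeal
  · rw [intersectOfDim_divisor_eq_zero δ u hp hx hu]
    exact AddSubgroup.zero_mem _
  let S := integralClosure (A ⧸ p.asIdeal) (FractionRing (A ⧸ p.asIdeal))
  have hfin : Module.Finite A S := Module.Finite.trans (A ⧸ p.asIdeal) S
  have hinj : Function.Injective (algebraMap (A ⧸ p.asIdeal) S) :=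
    FaithfulSMul.algebraMap_injective _ _
  have hker : ∀ a : A, algebraMap A S a = 0 ↔ a ∈ p.asIdeal := by
    intro a
    rw [IsScalarTower.algebraMap_apply A (A ⧸ p.asIdeal) S, map_eq_zero_iff _ hinj]
    exact Ideal.Quotient.eq_zero_iff_mem
  have hcomap : comap (algebraMap A S) ⊥ = p := by
    ext a
    exact hker a
  have hbir : ∀ s : S, ∃ c a : A, algebraMap A S c ≠ 0 ∧
      algebraMap A S c * s = algebraMap A S a := by
    intro s
    obtain ⟨a, c, hc, h⟩ := IsFractionRing.div_surjective (A := A ⧸ p.asIdeal)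
      (s : FractionRing (A ⧸ p.asIdeal))
    obtain ⟨a, rfl⟩ := Ideal.Quotient.mk_surjective a
    obtain ⟨c, rfl⟩ := Ideal.Quotient.mk_surjective c
    have hc0 : Ideal.Quotient.mk p.asIdeal c ≠ 0 := nonZeroDivisors.ne_zero hc
    refine ⟨c, a, ?_, Subtype.ext ?_⟩
    · rw [Ne, hker]
      exact fun h => hc0 (Ideal.Quotient.eq_zero_iff_mem.2 h)
    · change algebraMap (A ⧸ p.asIdeal) (FractionRing (A ⧸ p.asIdeal)) (Ideal.Quotient.mk _ c) *
        (s : FractionRing (A ⧸ p.asIdeal)) =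
          algebraMap (A ⧸ p.asIdeal) (FractionRing (A ⧸ p.asIdeal)) (Ideal.Quotient.mk _ a)
      rw [← h, mul_div_cancel₀]
      exact fun h => hc0 (IsFractionRing.injective _ (FractionRing (A ⧸ p.asIdeal))
        (h.trans (map_zero _).symm))
  have : IsIntegrallyClosed S := integralClosure.isIntegrallyClosedOfFiniteExtension
    (FractionRing (A ⧸ p.asIdeal))
  have hx' : algebraMap A S x ≠ 0 := fun h => hx ((hker x).1 h)
  have hu' : algebraMap A S u ≠ 0 := fun h => hu ((hker u).1 h)
  have key := intersectOfDim_divisor_mem_of_normalization δ S hbir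
    (by rw [hcomap]; exact hp) hx' hu'
  convert! key using 2
  simp only [hcomap]

theorem intersectOfDim_mem
    (hnorm : ∀ p : PrimeSpectrum A, Module.Finite (A ⧸ p.asIdeal)
      (integralClosure (A ⧸ p.asIdeal) (FractionRing (A ⧸ p.asIdeal))))
    (u : A) (i : ℤ) : rationallyTrivial δ i ≤
      (rationallyTrivial (δ.quotient u) (i - 1)).comap (intersectOfDim δ u i) := by
  rw [rationallyTrivial, AddSubgroup.closure_le]
  rintro _ ⟨p, hp, x, hx, rfl⟩
  exact intersectOfDim_divisor_mem δ (hnorm p) u hp hx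

theorem cycleClass_eq_zero_iff (α : Cycles δ) :
    cycleClass δ α = 0 ↔ ∀ i, α i ∈ rationallyTrivial δ i := by
  rw [DFinsupp.ext_iff]
  refine forall_congr' fun i => ?_
  change (QuotientAddGroup.mk (α i) : ChowOfDim δ i) = 0 ↔ _
  exact QuotientAddGroup.eq_zero_iff _

theorem rationallyEquivalent_iff (α β : Cycles δ) :
    RationallyEquivalent δ α β ↔ cycleClass δ (α - β) = 0 := by
  rw [cycleClass_eq_zero_iff]
  rfl

theorem cycleClass_surjective : Function.Surjective (cycleClass δ) := by
  intro z
  induction z using DirectSum.induction_on with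
  | zero => exact ⟨0, map_zero _⟩
  | of i x =>
    obtain ⟨x, rfl⟩ := QuotientAddGroup.mk_surjective x
    exact ⟨DirectSum.of _ i x, DirectSum.map_of _ _ _⟩
  | add x y hx hy =>
    obtain ⟨a, rfl⟩ := hx
    obtain ⟨b, rfl⟩ := hy
    exact ⟨a + b, map_add _ _ _⟩

theorem cycleClass_intersect_eq_zero
    (hnorm : ∀ p : PrimeSpectrum A, Module.Finite (A ⧸ p.asIdeal)
      (integralClosure (A ⧸ p.asIdeal) (FractionRing (A ⧸ p.asIdeal))))
    (u : A) (α : Cycles δ) (h : cycleClass δ α = 0) :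
    cycleClass (δ.quotient u) (intersect δ u α) = 0 := by
  classical
  rw [cycleClass_eq_zero_iff] at h
  rw [← DirectSum.sum_support_of α, map_sum, map_sum]
  refine Finset.sum_eq_zero fun i _ => ?_
  have hi : (QuotientAddGroup.mk (intersectOfDim δ u i (α i)) :
      ChowOfDim (δ.quotient u) (i - 1)) = 0 :=
    (QuotientAddGroup.eq_zero_iff _).2 (intersectOfDim_mem δ hnorm u i (h i))
  rw [intersect, DirectSum.toAddMonoid_of, AddMonoidHom.comp_apply, cycleClass, DirectSum.map_of]
  exact (congrArg _ hi).trans (map_zero _)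

end Main

end DivisorIntersection

open DivisorIntersection in
theorem corollary1p6 {A : Type*} [CommRing A] [IsNoetherianRing A] (δ : DimensionFunction A)
    (hnorm : ∀ p : PrimeSpectrum A, Module.Finite (A ⧸ p.asIdeal)
      (integralClosure (A ⧸ p.asIdeal) (FractionRing (A ⧸ p.asIdeal))))
    (u : A) :
    (∀ α β : Cycles δ, RationallyEquivalent δ α β →
      RationallyEquivalent (δ.quotient u) (intersect δ u α) (intersect δ u β)) ∧
    ∃! φ : Chow δ →+ Chow (δ.quotient u),
      ∀ α : Cycles δ, φ (cycleClass δ α) = cycleClass (δ.quotient u) (intersect δ u α) := by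
  have key := cycleClass_intersect_eq_zero δ hnorm u
  refine ⟨fun α β h => ?_, ?_⟩
  · rw [rationallyEquivalent_iff] at h ⊢
    rw [← map_sub]
    exact key _ h
  · have hker : (cycleClass δ).ker ≤ ((cycleClass (δ.quotient u)).comp (intersect δ u)).ker :=
      fun α hα => key α hα
    have hlift := AddMonoidHom.liftOfRightInverse_comp_apply (cycleClass δ) _
      (Function.rightInverse_surjInv (cycleClass_surjective δ)) ⟨_, hker⟩
    refine ⟨_, hlift, fun ψ hψ => ?_⟩
    exact (AddMonoidHom.cancel_right (cycleClass_surjective δ)).1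
      (AddMonoidHom.ext fun α => (hψ α).trans (hlift α).symm)
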